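/- Let $d\ge 4$, $m>0$, and let $v:\mathbb{R}^d\to\mathbb{R}$ satisfy $v\in L^d_{\mathrm{loc}}(\mathbb{R}^d)$ and, for some constants $C$, $\gamma>0$ and $b>2$, $|v(x)|\le C|x|^{-b}$ for almost all $|x|\ge\gamma$. Let $h=-\frac{1}{2m}\Delta+v$ be the corresponding Schrödinger operator in $L^2(\mathbb{R}^d)$, that is, the closure of its restriction to $C_c^\infty(\mathbb{R}^d)$. Assume that $h$ has a virtual level at the bottom of its spectrum: $h\ge 0$, and for every $\varepsilon>0$ the discrete spectrum (the set of isolated points of the spectrum that are eigenvalues of finite multiplicity) of $-\frac{1}{2m}\Delta+(1+\varepsilon)v$ is not empty. Let $\dot H^1(\mathbb{R}^d)$ be the completion of $C_c^\infty(\mathbb{R}^d)$ in the norm $\left(\int_{\mathbb{R}^d}|\nabla\varphi|^2\,dx\right)^{1/2}$, which by the Sobolev inequality is regarded as a space of functions in $L^{2d/(d-2)}(\mathbb{R}^d)$. Then there exists a real-valued function $f\in\dot H^1(\mathbb{R}^d)$, $f\ne 0$, with $f>0$ almost everywhere, such that $$\left(-\frac{1}{2m}\Delta+v\right)f=0$$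 in the sense of distributions; that is, $f$ and $vf$ are locally integrable and $\int_{\mathbb{R}^d} f\left(-\frac{1}{2m}\Delta\varphi+v\varphi\right)dx=0$ for every $\varphi\in C_c^\infty(\mathbb{R}^d)$. -/

import Mathlib

open MeasureTheory Filter Topology InnerProductSpace
open scoped ContDiff Laplacian

noncomputable section

namespace VirtualLevel

/-- The configuration space `ℝ^d` with its Euclidean norm. -/
abbrev Space (d : ℕ) : Type := EuclideanSpace ℝ (Fin d)

/-- The complex Hilbert space `L²(ℝ^d)`. -/
abbrev L2 (d : ℕ) : Type := Lp ℂ 2 (volume : Measure (Space d))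

/-- The short-range condition on the potential: `v ∈ L^d_loc(ℝ^d)`, and there are constants
`C`, `γ > 0` and `b > 2` with `|v(x)| ≤ C |x|^{-b}` for (almost) all `|x| ≥ γ`. -/
structure IsShortRange {d : ℕ} (v : Space d → ℝ) : Prop where
  memLp_loc : ∀ K : Set (Space d), IsCompact K → MemLp v (d : ENNReal) (volume.restrict K)
  decay : ∃ C γ b : ℝ, 0 < γ ∧ 2 < b ∧
    ∀ᵐ x ∂(volume : Measure (Space d)), γ ≤ ‖x‖ → |v x| ≤ C * ‖x‖ ^ (-b)

/-- The differential expression `-(1/2m) Δφ + vφ`. -/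
def schrodingerExpr {d : ℕ} (m : ℝ) (v : Space d → ℝ) (φ : Space d → ℂ) (x : Space d) : ℂ :=
  -((1 / (2 * m) : ℝ) : ℂ) * (Δ φ) x + (v x : ℂ) * φ x

theorem schrodingerExpr_add {d : ℕ} (m : ℝ) (v : Space d → ℝ) {φ ψ : Space d → ℂ}
    (hφ : ContDiff ℝ ∞ φ) (hψ : ContDiff ℝ ∞ ψ) (x : Space d) :
    schrodingerExpr m v (φ + ψ) x = schrodingerExpr m v φ x + schrodingerExpr m v ψ x := by
  simp only [schrodingerExpr, Pi.add_apply]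
  rw [ContDiffAt.laplacian_add (contDiff_infty.1 hφ 2).contDiffAt (contDiff_infty.1 hψ 2).contDiffAt]
  ring

theorem schrodingerExpr_smul {d : ℕ} (m : ℝ) (v : Space d → ℝ) {φ : Space d → ℂ}
    (hφ : ContDiff ℝ ∞ φ) (c : ℂ) (x : Space d) :
    schrodingerExpr m v (c • φ) x = c * schrodingerExpr m v φ x := by
  have h := laplacian_smul c (contDiff_infty.1 hφ 2).contDiffAt (x := x)
  simp only [schrodingerExpr, Pi.smul_apply, smul_eq_mul] at h ⊢
  rw [h]
  ring

theorem schrodingerExpr_zero {d : ℕ} (m : ℝ) (v : Space d → ℝ) (x : Space d) :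
    schrodingerExpr m v (0 : Space d → ℂ) x = 0 := by
  have h := schrodingerExpr_smul m v (φ := 0) contDiff_const 0 x
  simpa using h

/-- The graph in `L² × L²` of `-(1/2m) Δ + v` acting on the functions `φ ∈ C_c^∞(ℝ^d)`
(those with `-(1/2m) Δφ + vφ ∈ L²`, which is all of them when `v ∈ L²_loc`). -/
def minimalGraph {d : ℕ} (m : ℝ) (v : Space d → ℝ) : Submodule ℂ (L2 d × L2 d) where
  carrier := {p | ∃ φ : Space d → ℂ, ContDiff ℝ ∞ φ ∧ HasCompactSupport φ ∧
    (p.1 : Space d → ℂ) =ᵐ[volume] φ ∧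
    (p.2 : Space d → ℂ) =ᵐ[volume] schrodingerExpr m v φ}
  add_mem' := by
    rintro p q ⟨φ, hφ, hφc, hp1, hp2⟩ ⟨ψ, hψ, hψc, hq1, hq2⟩
    refine ⟨φ + ψ, hφ.add hψ, hφc.add hψc, ?_, ?_⟩
    · filter_upwards [Lp.coeFn_add p.1 q.1, hp1, hq1] with x hx h1 h2
      simp only [Prod.fst_add, hx, Pi.add_apply, h1, h2]
    · filter_upwards [Lp.coeFn_add p.2 q.2, hp2, hq2] with x hx h1 h2
      simp only [Prod.snd_add, hx, Pi.add_apply, h1, h2, schrodingerExpr_add m v hφ hψ]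
  zero_mem' := by
    refine ⟨0, contDiff_const, HasCompactSupport.zero, Lp.coeFn_zero _ _ _, ?_⟩
    filter_upwards [Lp.coeFn_zero ℂ 2 (volume : Measure (Space d))] with x hx
    simp only [Prod.snd_zero, hx, Pi.zero_apply, schrodingerExpr_zero]
  smul_mem' := by
    rintro c p ⟨φ, hφ, hφc, hp1, hp2⟩
    refine ⟨c • φ, hφ.const_smul c, hφc.smul_left (f := fun _ => c), ?_, ?_⟩
    · filter_upwards [Lp.coeFn_smul c p.1, hp1] with x hx h1
      simp only [Prod.smul_fst, hx, Pi.smul_apply, h1]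
    · filter_upwards [Lp.coeFn_smul c p.2, hp2] with x hx h1
      simp only [Prod.smul_snd, hx, Pi.smul_apply, h1, smul_eq_mul,
        schrodingerExpr_smul m v hφ]

/-- `minimalGraph` is single valued, so that it is the graph of a linear operator. -/
theorem minimalGraph_singleValued {d : ℕ} (m : ℝ) (v : Space d → ℝ) :
    ∀ p ∈ minimalGraph m v, p.1 = 0 → p.2 = 0 := by
  rintro ⟨u, w⟩ ⟨φ, hφ, -, h1, h2⟩ h0
  simp only at h0 h1 h2
  subst h0
  have hz : φ = 0 := by
    refine (hφ.continuous.ae_eq_iff_eq (μ := (volume : Measure (Space d)))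
      (continuous_zero : Continuous (0 : Space d → ℂ))).1 ?_
    exact h1.symm.trans (Lp.coeFn_zero _ _ _)
  subst hz
  refine Lp.ext ?_
  filter_upwards [h2, Lp.coeFn_zero ℂ 2 (volume : Measure (Space d))] with x hx hx0
  rw [hx, hx0, schrodingerExpr_zero, Pi.zero_apply]

/-- The operator `-(1/2m) Δ + v` in `L²(ℝ^d)` with domain `C_c^∞(ℝ^d)`. -/
def minimalOperator {d : ℕ} (m : ℝ) (v : Space d → ℝ) : L2 d →ₗ.[ℂ] L2 d :=
  (minimalGraph m v).toLinearPMap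

theorem minimalOperator_graph {d : ℕ} (m : ℝ) (v : Space d → ℝ) :
    (minimalOperator m v).graph = minimalGraph m v :=
  Submodule.toLinearPMap_graph_eq _ (minimalGraph_singleValued m v)

/-- The Schrödinger operator `h = -(1/2m) Δ + v` in `L²(ℝ^d)`: the closure of its restriction to
`C_c^∞(ℝ^d)`, on which it is essentially self-adjoint for the potentials considered here. -/
def schrodingerOperator {d : ℕ} (m : ℝ) (v : Space d → ℝ) : L2 d →ₗ.[ℂ] L2 d :=
  (minimalOperator m v).closure

section Spectrum

variable {H : Type*} [NormedAddCommGroup H] [InnerProductSpace ℂ H]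

/-- `z` is in the resolvent set of the unbounded operator `A`: the map `A - z` from the domain of
`A` to `H` has a bounded two-sided inverse `R`. -/
def IsResolventPoint (A : H →ₗ.[ℂ] H) (z : ℂ) : Prop :=
  ∃ R : H →L[ℂ] H,
    (∀ u : H, ∃ x : A.domain, (x : H) = R u ∧ A x - z • (x : H) = u) ∧
    ∀ x : A.domain, R (A x - z • (x : H)) = x

/-- The spectrum of an unbounded operator. -/
def unboundedSpectrum (A : H →ₗ.[ℂ] H) : Set ℂ := {z | ¬ IsResolventPoint A z}

/-- The eigenspace of an unbounded operator, as a subspace of its domain. -/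
def unboundedEigenspace (A : H →ₗ.[ℂ] H) (z : ℂ) : Submodule ℂ A.domain :=
  LinearMap.ker (A.toFun - z • A.domain.subtype)

/-- The discrete spectrum: the isolated points of the spectrum that are eigenvalues of finite
multiplicity. -/
def discreteSpectrum (A : H →ₗ.[ℂ] H) : Set ℂ :=
  {z | z ∈ unboundedSpectrum A ∧
    (∃ r : ℝ, 0 < r ∧ ∀ w ∈ unboundedSpectrum A, ‖w - z‖ < r → w = z) ∧
    unboundedEigenspace A z ≠ ⊥ ∧
    FiniteDimensional ℂ (unboundedEigenspace A z)}

/-- `A ≥ 0` in the sense of quadratic forms (`⟪A x, x⟫` is real when `A` is symmetric). -/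
def IsNonneg (A : H →ₗ.[ℂ] H) : Prop :=
  ∀ x : A.domain, 0 ≤ (inner ℂ (A x) (x : H)).re

end Spectrum

/-- `h = -(1/2m) Δ + v` has a virtual level at the bottom of its spectrum: `h ≥ 0`, and for every
`ε > 0` the discrete spectrum of `-(1/2m) Δ + (1 + ε) v` is not empty. -/
def HasVirtualLevel {d : ℕ} (m : ℝ) (v : Space d → ℝ) : Prop :=
  IsNonneg (schrodingerOperator m v) ∧
    ∀ ε : ℝ, 0 < ε → (discreteSpectrum (schrodingerOperator m fun x => (1 + ε) * v x)).Nonempty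

/-- Membership of a real function in the homogeneous Sobolev space `Ḣ¹(ℝ^d)`, `d ≥ 3`, the
completion of `C_c^∞(ℝ^d)` in the norm `‖∇φ‖_{L²}`. By the Sobolev inequality, sequences of test
functions that are Cauchy in this norm converge in `L^{2d/(d-2)}`, and this identifies the
completion with the space of their limits in `L^{2d/(d-2)}`. The field `G` below is the weak
gradient of `f`. -/
def MemHomogeneousSobolev {d : ℕ} (f : Space d → ℝ) : Prop :=
  MemLp f (ENNReal.ofReal (2 * d / (d - 2))) volume ∧
  ∃ (φ : ℕ → Space d → ℝ) (G : Space d → Space d),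
    (∀ n, ContDiff ℝ ∞ (φ n) ∧ HasCompactSupport (φ n)) ∧
    MemLp G 2 volume ∧
    Tendsto (fun n => eLpNorm (fun x => gradient (φ n) x - G x) 2 volume) atTop (𝓝 0) ∧
    Tendsto (fun n => eLpNorm (fun x => φ n x - f x) (ENNReal.ofReal (2 * d / (d - 2))) volume)
      atTop (𝓝 0)

/-- `(-(1/2m) Δ + v) f = 0` in the sense of distributions on `ℝ^d`; both `f` and `vf` are locally
integrable, so that they define distributions. -/
def IsDistributionalSolution {d : ℕ} (m : ℝ) (v f : Space d → ℝ) : Prop :=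
  LocallyIntegrable f volume ∧ LocallyIntegrable (fun x => v x * f x) volume ∧
  ∀ φ : Space d → ℝ, ContDiff ℝ ∞ φ → HasCompactSupport φ →
    ∫ x, (f x * (-(1 / (2 * m)) * (Δ φ) x) + v x * f x * φ x) = 0

end VirtualLevel

end

/-! Write E(φ) = (1/2m)∫|∇φ|² + ∫vφ². The operator enters only through this form. Since h ≥ 0, E is
nonnegative on test functions. Since |v| is small at infinity, Weyl sequences put [0, ∞) into the
spectrum of every -Δ/2m + (1+ε)v. If its form were nonnegative on test functions, each eigenvalue
would be real and nonnegative, hence not isolated. A nonempty discrete spectrum therefore yields a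
test function of negative energy for (1+ε)v (`exists_energy_neg`). Replacing it by a smoothed
absolute value, normalizing its gradient and letting ε tend to 0 gives test functions ψ_n ≥ 0 with
‖∇ψ_n‖ = 1 and E(ψ_n) → 0 (`exists_minimizing_sequence`).

The sequence converges strongly. The decay exponent b > 2 puts v into L^{d/2}, so by Hölder and
Sobolev the potential energy is bounded by ‖∇φ‖². It is also compact: v is approximated in L^{d/2}
by compactly supported continuous functions, and on balls Rellich's theorem follows from Poincaré's
inequality on small cubes and the convergence of all cube means along a subsequence
(`exists_subseq_tendsto_potential`). As E(ψ_n - ψ_k) ≤ 2E(ψ_n) + 2E(ψ_k), the gradients are then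
Cauchy, and ψ_n tends to some f in Ḣ¹. If f were 0, the potential energy would tend to 0 and E(ψ_n)
to 1/(2m), a contradiction. The Cauchy–Schwarz inequality E(ψ_n, φ)² ≤ E(ψ_n)E(φ) gives the equation
for f.

Positivity uses Moser's logarithmic estimate, applied to ψ_n rather than to f. Testing E(ψ_n, ·)
with φ²/(ψ_n + δ) bounds ∇log(1 + ψ_n/δ) in L² on balls, with a constant independent of δ, once n is
large depending on δ. Poincaré and Fatou transfer this to the mean oscillation of log(1 + f/δ). If f
vanished on a set of positive measure without vanishing almost everywhere, that oscillation would
blow up as δ → 0 (`ae_pos_of_bound_oscillation`). -/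

noncomputable section

namespace VirtualLevel

variable {d : ℕ}

/-! ### Test functions and their gradients -/

/-- Real test functions: smooth with compact support. -/
structure IsTest (φ : Space d → ℝ) : Prop where
  smooth : ContDiff ℝ ∞ φ
  compact : HasCompactSupport φ

theorem gradient_comp_deriv {F : ℝ → ℝ} {F' : ℝ} {u : Space d → ℝ} {x : Space d}
    (hF : HasDerivAt F F' (u x)) (hu : DifferentiableAt ℝ u x) :
    gradient (fun y => F (u y)) x = F' • gradient u x := by
  have h : fderiv ℝ (fun y => F (u y)) x = F' • fderiv ℝ u x :=
    (hF.comp_hasFDerivAt x hu.hasFDerivAt).fderiv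
  simp [gradient, h]

theorem gradient_fun_mul {u w : Space d → ℝ} {x : Space d}
    (hu : DifferentiableAt ℝ u x) (hw : DifferentiableAt ℝ w x) :
    gradient (fun y => u y * w y) x = u x • gradient w x + w x • gradient u x := by
  simp [gradient, fderiv_fun_mul hu hw]

theorem gradient_fun_add {u w : Space d → ℝ} {x : Space d}
    (hu : DifferentiableAt ℝ u x) (hw : DifferentiableAt ℝ w x) :
    gradient (fun y => u y + w y) x = gradient u x + gradient w x := by
  simp [gradient, fderiv_fun_add hu hw]

theorem gradient_fun_sub {u w : Space d → ℝ} {x : Space d}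
    (hu : DifferentiableAt ℝ u x) (hw : DifferentiableAt ℝ w x) :
    gradient (fun y => u y - w y) x = gradient u x - gradient w x := by
  simp [gradient, fderiv_fun_sub hu hw]

theorem gradient_const_mul {u : Space d → ℝ} {x : Space d} (c : ℝ)
    (hu : DifferentiableAt ℝ u x) :
    gradient (fun y => c * u y) x = c • gradient u x := by
  simp [gradient, fderiv_const_mul hu c]

theorem norm_gradient (u : Space d → ℝ) (x : Space d) : ‖gradient u x‖ = ‖fderiv ℝ u x‖ := by
  simp [gradient]

theorem continuous_gradient {u : Space d → ℝ} (hu : ContDiff ℝ ∞ u) : Continuous (gradient u) :=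
  (toDual ℝ (Space d)).symm.continuous.comp (hu.continuous_fderiv (by simp))

namespace IsTest

variable {φ ψ : Space d → ℝ}

theorem differentiableAt (hφ : IsTest φ) (x : Space d) : DifferentiableAt ℝ φ x :=
  (hφ.smooth.differentiable (by simp)) x

theorem continuous (hφ : IsTest φ) : Continuous φ := hφ.smooth.continuous

theorem add (hφ : IsTest φ) (hψ : IsTest ψ) : IsTest (fun x => φ x + ψ x) :=
  ⟨hφ.smooth.add hψ.smooth, hφ.compact.add hψ.compact⟩

theorem const_mul (hφ : IsTest φ) (c : ℝ) : IsTest (fun x => c * φ x) :=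
  ⟨contDiff_const.mul hφ.smooth, hφ.compact.mul_left (f := fun _ => c)⟩

theorem neg (hφ : IsTest φ) : IsTest (fun x => - φ x) := by simpa using hφ.const_mul (-1)

theorem sub (hφ : IsTest φ) (hψ : IsTest ψ) : IsTest (fun x => φ x - ψ x) := by
  simpa [sub_eq_add_neg] using hφ.add hψ.neg

theorem mul_smooth (hφ : IsTest φ) (hψ : ContDiff ℝ ∞ ψ) : IsTest (fun x => φ x * ψ x) :=
  ⟨hφ.smooth.mul hψ, hφ.compact.mul_right⟩

/-- Composition with a function smooth along the range that vanishes at `0`. -/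
theorem comp (hφ : IsTest φ) {F : ℝ → ℝ} (hF : ∀ x, ContDiffAt ℝ ∞ F (φ x)) (h0 : F 0 = 0) :
    IsTest (fun x => F (φ x)) :=
  ⟨contDiff_iff_contDiffAt.2 fun x => (hF x).comp x hφ.smooth.contDiffAt,
    hφ.compact.comp_left h0⟩

theorem continuous_gradient (hφ : IsTest φ) : Continuous (gradient φ) :=
  VirtualLevel.continuous_gradient hφ.smooth

theorem hasCompactSupport_gradient (hφ : IsTest φ) : HasCompactSupport (gradient φ) :=
  (hφ.compact.fderiv ℝ).comp_left (g := (toDual ℝ (Space d)).symm) (map_zero _)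

theorem memLp (hφ : IsTest φ) (p : ENNReal) : MemLp φ p (volume : Measure (Space d)) :=
  hφ.continuous.memLp_of_hasCompactSupport hφ.compact

theorem memLp_gradient (hφ : IsTest φ) (p : ENNReal) :
    MemLp (gradient φ) p (volume : Measure (Space d)) :=
  hφ.continuous_gradient.memLp_of_hasCompactSupport hφ.hasCompactSupport_gradient

theorem integrable_inner_gradient (hφ : IsTest φ) (hψ : IsTest ψ) :
    Integrable (fun x => inner ℝ (gradient φ x) (gradient ψ x)) :=
  (hφ.continuous_gradient.inner hψ.continuous_gradient).integrable_of_hasCompactSupport <|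
    hφ.hasCompactSupport_gradient.mono fun x hx => by
      contrapose! hx
      simp only [Function.mem_support, not_not] at hx
      simp [hx]

end IsTest

/-! ### The Laplacian in coordinates and integration by parts -/

/-- The standard basis vectors. -/
abbrev stdVec (i : Fin d) : Space d := EuclideanSpace.basisFun (Fin d) ℝ i

theorem laplacian_eq_sum_fderiv {F : Type*} [NormedAddCommGroup F] [NormedSpace ℝ F]
    {u : Space d → F} (hu : ContDiff ℝ ∞ u) (x : Space d) :
    (Δ u) x = ∑ i, fderiv ℝ (fun y => fderiv ℝ u y (stdVec i)) x (stdVec i) := by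
  rw [laplacian_eq_iteratedFDeriv_orthonormalBasis u (EuclideanSpace.basisFun (Fin d) ℝ)]
  refine Finset.sum_congr rfl fun i _ => ?_
  rw [iteratedFDeriv_two_apply]
  have h : DifferentiableAt ℝ (fderiv ℝ u) x :=
    ((hu.fderiv_right (m := ∞) (by simp)).differentiable (by simp)) x
  rw [fderiv_clm_apply h (differentiableAt_const _)]
  simp

theorem inner_gradient_eq_sum (u w : Space d → ℝ) (x : Space d) :
    inner ℝ (gradient u x) (gradient w x)
      = ∑ i, fderiv ℝ u x (stdVec i) * fderiv ℝ w x (stdVec i) := by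
  rw [← (EuclideanSpace.basisFun (Fin d) ℝ).sum_inner_mul_inner]
  refine Finset.sum_congr rfl fun i _ => ?_
  rw [inner_gradient_left, inner_gradient_right]
  simp

theorem contDiff_fderiv_apply {F : Type*} [NormedAddCommGroup F] [NormedSpace ℝ F]
    {u : Space d → F} (hu : ContDiff ℝ ∞ u) (e : Space d) :
    ContDiff ℝ ∞ (fun y => fderiv ℝ u y e) :=
  (hu.fderiv_right (m := ∞) (by simp)).clm_apply contDiff_const

theorem hasCompactSupport_fderiv_apply {F : Type*} [NormedAddCommGroup F] [NormedSpace ℝ F]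
    {u : Space d → F} (hu : HasCompactSupport u) (e : Space d) :
    HasCompactSupport (fun y => fderiv ℝ u y e) :=
  (hu.fderiv ℝ).comp_left (g := fun L : Space d →L[ℝ] F => L e) rfl

theorem contDiff_laplacian {F : Type*} [NormedAddCommGroup F] [NormedSpace ℝ F]
    {u : Space d → F} (hu : ContDiff ℝ ∞ u) : ContDiff ℝ ∞ (Δ u) := by
  rw [funext (laplacian_eq_sum_fderiv hu)]
  exact ContDiff.sum fun i _ => contDiff_fderiv_apply (contDiff_fderiv_apply hu _) _

theorem hasCompactSupport_laplacian {F : Type*} [NormedAddCommGroup F] [NormedSpace ℝ F]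
    {u : Space d → F} (hc : HasCompactSupport u) :
    HasCompactSupport (Δ u) := by
  refine hc.mono' fun x hx => ?_
  by_contra hx'
  apply hx
  have h0 : u =ᶠ[𝓝 x] fun _ => (0 : F) := notMem_tsupport_iff_eventuallyEq.1 hx'
  rw [laplacian_congr_nhds h0 |>.eq_of_nhds]
  have := laplacian_const (E := Space d) (c := (0 : F))
  exact congrFun this x

/-- Green's identity, one integration by parts per coordinate; compact support removes the boundary
terms. -/
theorem integral_inner_gradient {u w : Space d → ℝ} (hu : IsTest u) (hw : IsTest w) :
    ∫ x, inner ℝ (gradient u x) (gradient w x) = - ∫ x, u x * (Δ w) x := by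
  have hu1 := fun i : Fin d => contDiff_fderiv_apply hu.smooth (stdVec i)
  have hw1 := fun i : Fin d => contDiff_fderiv_apply hw.smooth (stdVec i)
  have hw2 := fun i : Fin d => contDiff_fderiv_apply (hw1 i) (stdVec i)
  have hi1 : ∀ i : Fin d, Integrable fun x => fderiv ℝ u x (stdVec i) * fderiv ℝ w x (stdVec i) :=
    fun i => ((hu1 i).continuous.mul (hw1 i).continuous).integrable_of_hasCompactSupport
      (hasCompactSupport_fderiv_apply hu.compact _).mul_right
  have hi2 : ∀ i : Fin d, Integrable fun x =>
      u x * fderiv ℝ (fun y => fderiv ℝ w y (stdVec i)) x (stdVec i) :=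
    fun i => (hu.continuous.mul (hw2 i).continuous).integrable_of_hasCompactSupport
      hu.compact.mul_right
  simp_rw [inner_gradient_eq_sum, laplacian_eq_sum_fderiv hw.smooth, Finset.mul_sum]
  rw [integral_finsetSum _ fun i _ => hi1 i, integral_finsetSum _ fun i _ => hi2 i,
    ← Finset.sum_neg_distrib]
  refine Finset.sum_congr rfl fun i _ => ?_
  rw [integral_mul_fderiv_eq_neg_fderiv_mul_of_integrable (hi1 i) (hi2 i), neg_neg]
  · exact (hu.continuous.mul (hw1 i).continuous).integrable_of_hasCompactSupport
      hu.compact.mul_right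
  · exact fun x _ => hu.differentiableAt x
  · exact fun x _ => (hw1 i).differentiable (by simp) x

/-! ### The energy form -/

/-- The bilinear form of `-(1/2m) Δ + v` on real test functions. -/
def energy (m : ℝ) (v u w : Space d → ℝ) : ℝ :=
  ∫ x, ((1 / (2 * m)) * inner ℝ (gradient u x) (gradient w x) + v x * (u x * w x))

theorem IsTest.integrable_mul {v u : Space d → ℝ} (hu : IsTest u)
    (hv : LocallyIntegrable v (volume : Measure (Space d))) :
    Integrable (fun x => v x * u x) := by
  simpa [smul_eq_mul, mul_comm] using
    hv.integrable_smul_left_of_hasCompactSupport hu.continuous hu.compact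

section Energy

variable {m : ℝ} {v u w : Space d → ℝ}

theorem energy_integrable (hv : LocallyIntegrable v (volume : Measure (Space d)))
    (hu : IsTest u) (hw : IsTest w) : Integrable fun x =>
      ((1 / (2 * m)) * inner ℝ (gradient u x) (gradient w x) + v x * (u x * w x)) :=
  ((hu.integrable_inner_gradient hw).const_mul _).add
    ((hu.mul_smooth hw.smooth).integrable_mul hv)

theorem energy_eq (hv : LocallyIntegrable v (volume : Measure (Space d)))
    (hu : IsTest u) (hw : IsTest w) : energy m v u w =
      (1 / (2 * m)) * (∫ x, inner ℝ (gradient u x) (gradient w x)) + ∫ x, v x * (u x * w x) := by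
  rw [energy, integral_add ((hu.integrable_inner_gradient hw).const_mul _)
    ((hu.mul_smooth hw.smooth).integrable_mul hv), integral_const_mul]

theorem energy_self_eq (hv : LocallyIntegrable v (volume : Measure (Space d)))
    (hu : IsTest u) : energy m v u u =
      (1 / (2 * m)) * (∫ x, ‖gradient u x‖ ^ 2) + ∫ x, v x * u x ^ 2 := by
  rw [energy_eq hv hu hu]
  simp only [real_inner_self_eq_norm_sq, pow_two]

theorem energy_comm (m : ℝ) (v u w : Space d → ℝ) : energy m v u w = energy m v w u := by
  unfold energy
  congr 1
  ext x
  rw [real_inner_comm, mul_comm (u x)]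

theorem energy_add_mul_self (hv : LocallyIntegrable v (volume : Measure (Space d)))
    (hu : IsTest u) (hw : IsTest w) (t : ℝ) :
    energy m v (fun x => u x + t * w x) (fun x => u x + t * w x) =
      energy m v u u + 2 * t * energy m v u w + t ^ 2 * energy m v w w := by
  unfold energy
  rw [← integral_const_mul, ← integral_const_mul, ← integral_add, ← integral_add]
  · congr 1
    ext x
    rw [gradient_fun_add (hu.differentiableAt x) ((hw.const_mul t).differentiableAt x),
      gradient_const_mul t (hw.differentiableAt x)]
    simp only [inner_add_left, inner_add_right, real_inner_smul_left, real_inner_smul_right,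
      real_inner_comm (gradient u x) (gradient w x)]
    ring
  · exact (energy_integrable hv hu hu).add ((energy_integrable hv hu hw).const_mul _)
  · exact (energy_integrable hv hw hw).const_mul _
  · exact energy_integrable hv hu hu
  · exact (energy_integrable hv hu hw).const_mul _

theorem energy_const_mul_self (t : ℝ) (hu : IsTest u) :
    energy m v (fun x => t * u x) (fun x => t * u x) = t ^ 2 * energy m v u u := by
  unfold energy
  rw [← integral_const_mul]
  congr 1
  ext x
  rw [gradient_const_mul t (hu.differentiableAt x)]
  simp only [real_inner_smul_left, real_inner_smul_right]
  ring

/-- Cauchy–Schwarz for a form that is only semidefinite: the quadratic polynomial t ↦ E(u + tw) is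
nonnegative, so its discriminant is at most 0. -/
theorem energy_sq_le (hv : LocallyIntegrable v (volume : Measure (Space d)))
    (hpos : ∀ φ, IsTest φ → 0 ≤ energy m v φ φ) (hu : IsTest u) (hw : IsTest w) :
    energy m v u w ^ 2 ≤ energy m v u u * energy m v w w := by
  have h := discrim_le_zero (a := energy m v w w) (b := 2 * energy m v u w)
    (c := energy m v u u) fun t => by
      have := hpos _ (hu.add (hw.const_mul t))
      rw [energy_add_mul_self hv hu hw] at this
      linarith
  rw [discrim] at h
  linarith

/-- The parallelogram law, with the nonnegative term E(u + w) dropped. It makes a minimizing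
sequence Cauchy in energy. -/
theorem energy_sub_self_le (hv : LocallyIntegrable v (volume : Measure (Space d)))
    (hpos : ∀ φ, IsTest φ → 0 ≤ energy m v φ φ) (hu : IsTest u) (hw : IsTest w) :
    energy m v (fun x => u x - w x) (fun x => u x - w x)
      ≤ 2 * energy m v u u + 2 * energy m v w w := by
  have h1 := energy_add_mul_self (m := m) hv hu hw (-1)
  have h2 := energy_add_mul_self (m := m) hv hu hw 1
  have h3 := hpos _ (hu.add (hw.const_mul 1))
  have h4 : (fun x => u x + -1 * w x) = fun x => u x - w x := by ext x; ring
  rw [h4] at h1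
  linarith

/-- With both derivatives on w, the form needs no derivative of u, so limits in u can be taken in an
L^p norm of u alone. -/
theorem energy_eq_integral (hv : LocallyIntegrable v (volume : Measure (Space d)))
    (hu : IsTest u) (hw : IsTest w) : energy m v u w =
      ∫ x, (u x * (-(1 / (2 * m)) * (Δ w) x) + v x * u x * w x) := by
  have hi : Integrable fun x => u x * (Δ w) x :=
    (hu.continuous.mul (contDiff_laplacian hw.smooth).continuous).integrable_of_hasCompactSupport
      hu.compact.mul_right
  rw [energy_eq hv hu hw, integral_inner_gradient hu hw, mul_neg, ← neg_mul, ← integral_const_mul,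
    ← integral_add (hi.const_mul _) ((hu.mul_smooth hw.smooth).integrable_mul hv)]
  congr 1
  ext x
  ring

end Energy

/-! ### Local integrability of short-range potentials -/

theorem IsShortRange.memLp_ball {v : Space d → ℝ} (hv : IsShortRange v) {p : ENNReal}
    (hp : p ≤ d) {K : Set (Space d)} (hK : IsCompact K) : MemLp v p (volume.restrict K) :=
  haveI : IsFiniteMeasure ((volume : Measure (Space d)).restrict K) :=
    ⟨by simpa using hK.measure_lt_top⟩
  (hv.memLp_loc K hK).mono_exponent hp

theorem IsShortRange.locallyIntegrable {v : Space d → ℝ} (hv : IsShortRange v) (hd : 1 ≤ d) :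
    LocallyIntegrable v (volume : Measure (Space d)) := by
  rw [locallyIntegrable_iff]
  intro K hK
  exact memLp_one_iff_integrable.1 (hv.memLp_ball (by exact_mod_cast hd) hK)

theorem IsShortRange.aestronglyMeasurable {v : Space d → ℝ} (hv : IsShortRange v) (hd : 1 ≤ d) :
    AEStronglyMeasurable v (volume : Measure (Space d)) :=
  (hv.locallyIntegrable hd).aestronglyMeasurable

theorem IsShortRange.const_mul {v : Space d → ℝ} (hv : IsShortRange v) (c : ℝ) :
    IsShortRange fun x => c * v x := by
  refine ⟨fun K hK => (hv.memLp_loc K hK).const_mul c, ?_⟩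
  obtain ⟨C, γ, b, hγ, hb, h⟩ := hv.decay
  refine ⟨|c| * C, γ, b, hγ, hb, h.mono fun x hx hg => ?_⟩
  rw [abs_mul, mul_assoc]
  exact mul_le_mul_of_nonneg_left (hx hg) (abs_nonneg c)

/-- A locally `p`-integrable function times a continuous function with compact support is in `L^p`. -/
theorem memLp_mul_of_hasCompactSupport {F : Type*} [NormedRing F] {v φ : Space d → F}
    {p : ENNReal}
    (hv : ∀ K : Set (Space d), IsCompact K → MemLp v p (volume.restrict K))
    (hφ : Continuous φ) (hc : HasCompactSupport φ) :
    MemLp (fun x => v x * φ x) p (volume : Measure (Space d)) := by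
  have h0 := hv _ hc.isCompact
  obtain ⟨M, hM⟩ := hc.exists_bound_of_continuous hφ
  have h1 : MemLp (fun x => v x * φ x) p (volume.restrict (tsupport φ)) := by
    refine MemLp.of_le_mul (c := M) h0 (h0.aestronglyMeasurable.mul hφ.aestronglyMeasurable) ?_
    refine .of_forall fun x => (norm_mul_le _ _).trans ?_
    rw [mul_comm]
    exact mul_le_mul_of_nonneg_right (hM x) (norm_nonneg _)
  have h2 := (memLp_indicator_iff_restrict (isClosed_tsupport φ).measurableSet).2 h1
  have h3 : (fun x => v x * φ x) = (tsupport φ).indicator fun x => v x * φ x := by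
    ext x
    by_cases hx : x ∈ tsupport φ
    · simp [hx]
    · simp [hx, image_eq_zero_of_notMem_tsupport hx]
  rw [h3]
  exact h2

/-! ### The quadratic form of the operator -/

theorem IsTest.re {φ : Space d → ℂ} (hφ : ContDiff ℝ ∞ φ) (hc : HasCompactSupport φ) :
    IsTest fun x => (φ x).re :=
  ⟨Complex.reCLM.contDiff.comp hφ, hc.comp_left (g := Complex.re) rfl⟩

theorem IsTest.im {φ : Space d → ℂ} (hφ : ContDiff ℝ ∞ φ) (hc : HasCompactSupport φ) :
    IsTest fun x => (φ x).im :=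
  ⟨Complex.imCLM.contDiff.comp hφ, hc.comp_left (g := Complex.im) rfl⟩

theorem schrodingerExpr_re {m : ℝ} {v : Space d → ℝ} {φ : Space d → ℂ} (hφ : ContDiff ℝ ∞ φ)
    (x : Space d) : (schrodingerExpr m v φ x).re =
      -(1 / (2 * m)) * (Δ fun y => (φ y).re) x + v x * (φ x).re := by
  have h : (Δ fun y => (φ y).re) x = ((Δ φ) x).re :=
    (contDiff_infty.1 hφ 2).contDiffAt.laplacian_CLM_comp_left (l := Complex.reCLM)
  rw [h, schrodingerExpr, ← Complex.ofReal_neg, Complex.add_re, Complex.re_ofReal_mul,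
    Complex.re_ofReal_mul]

theorem schrodingerExpr_im {m : ℝ} {v : Space d → ℝ} {φ : Space d → ℂ} (hφ : ContDiff ℝ ∞ φ)
    (x : Space d) : (schrodingerExpr m v φ x).im =
      -(1 / (2 * m)) * (Δ fun y => (φ y).im) x + v x * (φ x).im := by
  have h : (Δ fun y => (φ y).im) x = ((Δ φ) x).im :=
    (contDiff_infty.1 hφ 2).contDiffAt.laplacian_CLM_comp_left (l := Complex.imCLM)
  rw [h, schrodingerExpr, ← Complex.ofReal_neg, Complex.add_im, Complex.im_ofReal_mul,
    Complex.im_ofReal_mul]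

theorem integrable_mul_schrodinger {m : ℝ} {v u w : Space d → ℝ}
    (hv : LocallyIntegrable v (volume : Measure (Space d))) (hu : IsTest u) (hw : IsTest w) :
    Integrable fun x => u x * (-(1 / (2 * m)) * (Δ w) x + v x * w x) := by
  have h1 : Integrable fun x => u x * (Δ w) x :=
    (hu.continuous.mul (contDiff_laplacian hw.smooth).continuous).integrable_of_hasCompactSupport
      hu.compact.mul_right
  have h2 := (hu.mul_smooth hw.smooth).integrable_mul hv
  refine ((h1.const_mul (-(1 / (2 * m)))).add h2).congr (.of_forall fun x => ?_)
  simp only [Pi.add_apply]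
  ring

/-- On the minimal domain, the quadratic form of the operator is the energy of the real and the
imaginary part. -/
theorem inner_of_mem_minimalGraph {m : ℝ} {v : Space d → ℝ}
    (hv : LocallyIntegrable v (volume : Measure (Space d))) {p : L2 d × L2 d} {φ : Space d → ℂ}
    (hφ : ContDiff ℝ ∞ φ) (hc : HasCompactSupport φ)
    (h1 : (p.1 : Space d → ℂ) =ᵐ[volume] φ)
    (h2 : (p.2 : Space d → ℂ) =ᵐ[volume] schrodingerExpr m v φ) :
    inner ℂ p.2 p.1 = ((energy m v (fun x => (φ x).re) (fun x => (φ x).re)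
      + energy m v (fun x => (φ x).im) (fun x => (φ x).im) : ℝ) : ℂ) := by
  have ha := IsTest.re hφ hc
  have hb := IsTest.im hφ hc
  set a := fun x => (φ x).re
  set b := fun x => (φ x).im
  set L : (Space d → ℝ) → Space d → ℝ := fun w x => -(1 / (2 * m)) * (Δ w) x + v x * w x with hL
  have hE : ∀ {u w}, IsTest u → IsTest w → energy m v u w = ∫ x, u x * L w x := by
    intro u w hu hw
    rw [energy_eq_integral hv hu hw]
    congr 1
    ext x
    simp only [hL]
    ring
  have hI : ∀ {u w}, IsTest u → IsTest w → Integrable fun x => u x * L w x :=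
    fun hu hw => integrable_mul_schrodinger hv hu hw
  -- The imaginary part integrates to E(b, a) - E(a, b), which vanishes by symmetry of the form.
  have hpt : (fun x => inner ℂ (p.2 x) (p.1 x)) =ᵐ[volume] fun x =>
      (((a x * L a x + b x * L b x : ℝ)) : ℂ) + ((b x * L a x - a x * L b x : ℝ) : ℂ) * Complex.I := by
    filter_upwards [h1, h2] with x hx1 hx2
    rw [hx1, hx2]
    have hr : (schrodingerExpr m v φ x).re = L a x := schrodingerExpr_re hφ x
    have hi : (schrodingerExpr m v φ x).im = L b x := schrodingerExpr_im hφ x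
    apply Complex.ext
    · simp [hr, hi, a, b]
    · simp [hr, hi, a, b]; ring
  have hint1 : Integrable fun x => ((a x * L a x + b x * L b x : ℝ) : ℂ) :=
    ((hI ha ha).add (hI hb hb)).ofReal
  have hint2 : Integrable fun x => ((b x * L a x - a x * L b x : ℝ) : ℂ) * Complex.I :=
    (((hI hb ha).sub (hI ha hb)).ofReal (𝕜 := ℂ)).mul_const Complex.I
  rw [L2.inner_def, integral_congr_ae hpt, integral_add hint1 hint2, integral_mul_const,
    integral_complex_ofReal, integral_complex_ofReal, integral_add (hI ha ha) (hI hb hb),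
    integral_sub (hI hb ha) (hI ha hb), ← hE ha ha, ← hE hb hb, ← hE ha hb, ← hE hb ha,
    energy_comm m v b a]
  simp

theorem memLp_schrodingerExpr {m : ℝ} {v : Space d → ℝ} (hv : IsShortRange v) (hd : 2 ≤ d)
    {φ : Space d → ℂ} (hφ : ContDiff ℝ ∞ φ) (hc : HasCompactSupport φ) :
    MemLp (schrodingerExpr m v φ) 2 (volume : Measure (Space d)) := by
  have h1 : MemLp (Δ φ) 2 (volume : Measure (Space d)) :=
    (contDiff_laplacian hφ).continuous.memLp_of_hasCompactSupport (hasCompactSupport_laplacian hc)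
  have h2 : MemLp (fun x => (v x : ℂ) * φ x) 2 (volume : Measure (Space d)) :=
    memLp_mul_of_hasCompactSupport
      (fun K hK => (hv.memLp_ball (by exact_mod_cast hd) hK).ofReal) hφ.continuous hc
  exact (h1.const_mul _).add h2

theorem exists_mem_minimalGraph {m : ℝ} {v : Space d → ℝ} (hv : IsShortRange v) (hd : 2 ≤ d)
    {φ : Space d → ℂ} (hφ : ContDiff ℝ ∞ φ) (hc : HasCompactSupport φ) :
    ∃ p ∈ minimalGraph m v, (p.1 : Space d → ℂ) =ᵐ[volume] φ ∧
      (p.2 : Space d → ℂ) =ᵐ[volume] schrodingerExpr m v φ := by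
  have h1 : MemLp φ 2 (volume : Measure (Space d)) := hφ.continuous.memLp_of_hasCompactSupport hc
  have h2 := memLp_schrodingerExpr (m := m) hv hd hφ hc
  exact ⟨(h1.toLp φ, h2.toLp _), ⟨φ, hφ, hc, h1.coeFn_toLp, h2.coeFn_toLp⟩, h1.coeFn_toLp,
    h2.coeFn_toLp⟩

theorem minimalGraph_le_graph (m : ℝ) (v : Space d → ℝ) :
    minimalGraph m v ≤ (schrodingerOperator m v).graph := by
  rw [← minimalOperator_graph]
  exact LinearPMap.le_graph_of_le (LinearPMap.le_closure _)

/-- Closability need not be known: for a non-closable operator `LinearPMap.closure` returns the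
operator itself, whose graph lies in the closure trivially. -/
theorem mem_closure_minimalGraph (m : ℝ) (v : Space d → ℝ) (x : (schrodingerOperator m v).domain) :
    ((x : L2 d), schrodingerOperator m v x) ∈ closure (minimalGraph m v : Set (L2 d × L2 d)) := by
  have hx : ((x : L2 d), schrodingerOperator m v x) ∈ (minimalOperator m v).closure.graph :=
    (schrodingerOperator m v).mem_graph x
  by_cases h : (minimalOperator m v).IsClosable
  · rw [← h.graph_closure_eq_closure_graph, minimalOperator_graph] at hx
    exact hx
  · rw [LinearPMap.closure_def' h, minimalOperator_graph] at hx
    exact subset_closure hx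

/-- Test functions lie in the operator domain because v is locally square integrable; this passes
from the operator to its form. -/
theorem energy_nonneg_of_isNonneg {m : ℝ} {v : Space d → ℝ} (hv : IsShortRange v) (hd : 2 ≤ d)
    (h : IsNonneg (schrodingerOperator m v)) {φ : Space d → ℝ} (hφ : IsTest φ) :
    0 ≤ energy m v φ φ := by
  have hs : ContDiff ℝ ∞ fun x => (φ x : ℂ) := Complex.ofRealCLM.contDiff.comp hφ.smooth
  have hc : HasCompactSupport fun x => (φ x : ℂ) :=
    hφ.compact.comp_left (g := Complex.ofReal) Complex.ofReal_zero
  obtain ⟨p, hp, h1, h2⟩ := exists_mem_minimalGraph (m := m) hv hd hs hc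
  have h3 := inner_of_mem_minimalGraph (hv.locallyIntegrable (by omega)) hs hc h1 h2
  obtain ⟨y, hy1, hy2⟩ := (LinearPMap.mem_graph_iff _).1 (minimalGraph_le_graph m v hp)
  have h4 := h y
  rw [hy1, hy2, h3, Complex.ofReal_re] at h4
  have h5 : energy m v (fun x => ((φ x : ℂ)).im) (fun x => ((φ x : ℂ)).im) = 0 := by
    have : (fun x => ((φ x : ℂ)).im) = fun x => (0 : ℝ) * φ x := by ext x; simp
    rw [this, energy_const_mul_self _ hφ]
    simp
  rw [h5, add_zero] at h4
  exact h4

/-! ### Weyl sequences: the spectrum contains the half-line -/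

/-- The plane wave `exp (i k x_j)`. -/
def planeWave (k : ℝ) (j : Fin d) (x : Space d) : ℂ := Complex.exp ((k * x j : ℝ) * Complex.I)

theorem norm_planeWave (k : ℝ) (j : Fin d) (x : Space d) : ‖planeWave k j x‖ = 1 :=
  Complex.norm_exp_ofReal_mul_I _

theorem contDiff_planeWave (k : ℝ) (j : Fin d) : ContDiff ℝ ∞ (planeWave k j) := by
  have h : ContDiff ℝ ∞ fun x : Space d => k * x j :=
    contDiff_const.mul (EuclideanSpace.proj (𝕜 := ℝ) j).contDiff
  exact Complex.contDiff_exp.comp ((Complex.ofRealCLM.contDiff.comp h).mul contDiff_const)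

theorem fderiv_planeWave (k : ℝ) (j : Fin d) (x e : Space d) :
    fderiv ℝ (planeWave k j) x e = (k * e j : ℝ) * Complex.I * planeWave k j x := by
  have h1 : HasFDerivAt (fun x : Space d => x j)
      (EuclideanSpace.proj (𝕜 := ℝ) j : Space d →L[ℝ] ℝ) x :=
    (EuclideanSpace.proj (𝕜 := ℝ) j : Space d →L[ℝ] ℝ).hasFDerivAt
  have h2 : HasFDerivAt (fun x : Space d => ((k * x j : ℝ) : ℂ) * Complex.I) _ x :=
    (Complex.ofRealCLM.hasFDerivAt.comp x (h1.const_mul k)).mul_const Complex.I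
  have h3 : HasFDerivAt (planeWave k j) _ x := h2.cexp
  rw [h3.fderiv]
  simp [planeWave]
  ring

theorem fderiv_mul_planeWave {a : Space d → ℂ} (ha : ContDiff ℝ ∞ a) (k : ℝ) (j : Fin d)
    (x e : Space d) : fderiv ℝ (fun y => a y * planeWave k j y) x e =
      (fderiv ℝ a x e + (k * e j : ℝ) * Complex.I * a x) * planeWave k j x := by
  rw [fderiv_fun_mul (ha.differentiable (by simp) x)
    ((contDiff_planeWave k j).differentiable (by simp) x)]
  simp only [add_apply, smul_apply, smul_eq_mul,
    fderiv_planeWave]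
  ring

/-- Conjugation by the plane wave turns ∂_j into ∂_j + ik and leaves the other derivatives
unchanged; the extra terms come from squaring ∂_j + ik. -/
theorem laplacian_mul_planeWave {a : Space d → ℂ} (ha : ContDiff ℝ ∞ a) (k : ℝ) (j : Fin d)
    (x : Space d) : (Δ fun y => a y * planeWave k j y) x =
      ((Δ a) x + 2 * k * Complex.I * fderiv ℝ a x (stdVec j) - k ^ 2 * a x) * planeWave k j x := by
  rw [laplacian_eq_sum_fderiv (ha.mul (contDiff_planeWave k j)), laplacian_eq_sum_fderiv ha]
  have key : ∀ i : Fin d, fderiv ℝ (fun y => fderiv ℝ (fun y => a y * planeWave k j y) y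
      (stdVec i)) x (stdVec i) = fderiv ℝ (fun y => fderiv ℝ a y (stdVec i)) x (stdVec i)
        * planeWave k j x + if i = j then (2 * k * Complex.I * fderiv ℝ a x (stdVec i)
          - k ^ 2 * a x) * planeWave k j x else 0 := by
    intro i
    have h1 : (fun y => fderiv ℝ (fun y => a y * planeWave k j y) y (stdVec i)) =
        fun y => (fderiv ℝ a y (stdVec i) + (k * (stdVec i : Space d) j : ℝ) * Complex.I * a y)
          * planeWave k j y := by
      ext y
      exact fderiv_mul_planeWave ha k j y _
    have h2 : ContDiff ℝ ∞ fun y => ((k * (stdVec i : Space d) j : ℝ) : ℂ) * Complex.I * a y :=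
      contDiff_const.mul ha
    have h3 := contDiff_fderiv_apply ha (stdVec i)
    rw [h1, fderiv_mul_planeWave (h3.add h2), fderiv_fun_add (h3.differentiable (by simp) x)
      (h2.differentiable (by simp) x), fderiv_const_mul (ha.differentiable (by simp) x)]
    by_cases hij : i = j
    · subst hij
      simp
      ring_nf
      simp
      ring
    · have : j ≠ i := fun h => hij h.symm
      simp [hij, this]
  rw [Finset.sum_congr rfl fun i _ => key i, Finset.sum_add_distrib, ← Finset.sum_mul,
    Finset.sum_ite_eq' Finset.univ j]
  simp
  ring

theorem fderiv_comp_smul_sub {F : Type*} [NormedAddCommGroup F] [NormedSpace ℝ F]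
    {b : Space d → F} (hb : ContDiff ℝ ∞ b) (t : ℝ) (x₀ x e : Space d) :
    fderiv ℝ (fun y => b (t • (y - x₀))) x e = t • fderiv ℝ b (t • (x - x₀)) e := by
  have h1 : HasFDerivAt (fun y : Space d => t • (y - x₀)) (t • ContinuousLinearMap.id ℝ (Space d)) x :=
    ((hasFDerivAt_id x).sub_const x₀).const_smul t
  have h2 := ((hb.differentiable (by simp) (t • (x - x₀))).hasFDerivAt).comp x h1
  have h3 : fderiv ℝ (fun y => b (t • (y - x₀))) x = _ := h2.fderiv
  rw [h3]
  simp

theorem contDiff_comp_smul_sub {F : Type*} [NormedAddCommGroup F] [NormedSpace ℝ F]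
    {b : Space d → F} (hb : ContDiff ℝ ∞ b) (t : ℝ) (x₀ : Space d) :
    ContDiff ℝ ∞ fun y => b (t • (y - x₀)) :=
  hb.comp (show ContDiff ℝ ∞ fun y : Space d => t • (y - x₀) by fun_prop)

theorem laplacian_comp_smul_sub {F : Type*} [NormedAddCommGroup F] [NormedSpace ℝ F]
    {b : Space d → F} (hb : ContDiff ℝ ∞ b) (t : ℝ) (x₀ x : Space d) :
    (Δ fun y => b (t • (y - x₀))) x = t ^ 2 • (Δ b) (t • (x - x₀)) := by
  rw [laplacian_eq_sum_fderiv (contDiff_comp_smul_sub hb t x₀), laplacian_eq_sum_fderiv hb,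
    Finset.smul_sum]
  refine Finset.sum_congr rfl fun i _ => ?_
  have h1 : (fun y => fderiv ℝ (fun y => b (t • (y - x₀))) y (stdVec i)) =
      fun y => t • fderiv ℝ b (t • (y - x₀)) (stdVec i) :=
    funext fun y => fderiv_comp_smul_sub hb t x₀ y _
  have h2 := contDiff_fderiv_apply hb (stdVec i)
  have h3 := (contDiff_comp_smul_sub h2 t x₀).differentiable (by simp) x
  rw [h1, fderiv_fun_const_smul h3, smul_apply,
    fderiv_comp_smul_sub h2, smul_smul, pow_two]

/-- A potential bounded by a negative power at infinity is uniformly small far away. -/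
theorem IsShortRange.eventually_small {v : Space d → ℝ} (hv : IsShortRange v) {ε : ℝ}
    (hε : 0 < ε) : ∃ R : ℝ, 0 < R ∧ ∀ᵐ x ∂(volume : Measure (Space d)), R ≤ ‖x‖ → |v x| ≤ ε := by
  obtain ⟨C, γ, b, hγ, hb, h⟩ := hv.decay
  have ht : Tendsto (fun r : ℝ => C * r ^ (-b)) atTop (𝓝 (C * 0)) :=
    (tendsto_rpow_neg_atTop (by linarith)).const_mul C
  rw [mul_zero] at ht
  obtain ⟨R, hR⟩ := eventually_atTop.1 (ht.eventually (gt_mem_nhds hε))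
  refine ⟨max R γ, lt_max_of_lt_right hγ, h.mono fun x hx hxR => ?_⟩
  exact (hx ((le_max_right _ _).trans hxR)).trans (hR _ ((le_max_left _ _).trans hxR)).le

/-- Approximate eigenfunctions for every nonnegative energy. -/
theorem exists_approximate_eigenfunction {m : ℝ} (hm : 0 < m) {v : Space d → ℝ}
    (hv : IsShortRange v) (hd : 2 ≤ d) {l : ℝ} (hl : 0 ≤ l) {η : ℝ} (hη : 0 < η) :
    ∃ p ∈ minimalGraph m v, 0 < ‖p.1‖ ∧ ‖p.2 - (l : ℂ) • p.1‖ ≤ η * ‖p.1‖ := by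
  set j : Fin d := ⟨0, by omega⟩
  -- The wave number for which the plane wave has kinetic energy k²/(2m) = l.
  set k : ℝ := Real.sqrt (2 * m * l) with hk
  have hk2 : k ^ 2 = 2 * m * l := Real.sq_sqrt (by positivity)
  let g : ContDiffBump (0 : Space d) := ⟨1, 2, one_pos, one_lt_two⟩
  set b : Space d → ℂ := fun x => (g x : ℂ) with hb
  have hbs : ContDiff ℝ ∞ b := Complex.ofRealCLM.contDiff.comp g.contDiff
  have hbc : HasCompactSupport b :=
    g.hasCompactSupport.comp_left (g := Complex.ofReal) Complex.ofReal_zero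
  have hb1 : ∀ y, ‖b y‖ ≤ 1 := fun y => by
    simp only [hb, Complex.norm_real, Real.norm_eq_abs, abs_of_nonneg g.nonneg]
    exact g.le_one
  have hb0 : ∀ y, 2 < ‖y‖ → b =ᶠ[𝓝 y] fun _ => 0 := fun y hy => by
    have : y ∉ tsupport b := by
      refine fun h => ?_
      have h1 : tsupport b ⊆ Metric.closedBall 0 2 := by
        refine closure_minimal (fun z hz => ?_) Metric.isClosed_closedBall
        have : z ∈ Function.support g := by
          intro h0
          exact hz (by simp [hb, h0])
        rw [g.support_eq] at this
        exact Metric.ball_subset_closedBall this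
      have := h1 h
      rw [mem_closedBall_zero_iff] at this
      linarith
    exact notMem_tsupport_iff_eventuallyEq.1 this
  obtain ⟨C₁, hC₁⟩ := (hasCompactSupport_fderiv_apply hbc (stdVec j)).exists_bound_of_continuous
    (contDiff_fderiv_apply hbs _).continuous
  obtain ⟨C₂, hC₂⟩ := (hasCompactSupport_laplacian hbc).exists_bound_of_continuous
    (contDiff_laplacian hbs).continuous
  -- A pointwise bound for the residual when the bump is stretched by 1/t: Laplacian of the bump,
  -- cross term with the wave, and a potential of size at most t. Below, √(2^d) is the square root
  -- of the volume ratio between the ball of radius 2/t containing the support and the ball of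
  -- radius 1/t where the bump is 1.
  set κ : ℝ → ℝ := fun t => 1 / (2 * m) * (t ^ 2 * C₂ + 2 * k * (t * C₁)) + t with hκ
  have hκ0 : Tendsto (fun t => κ t * Real.sqrt (2 ^ d)) (𝓝 0) (𝓝 (κ 0 * Real.sqrt (2 ^ d))) := by
    have : Continuous fun t => κ t * Real.sqrt (2 ^ d) := by fun_prop
    exact this.tendsto 0
  have hκ00 : κ 0 * Real.sqrt (2 ^ d) < η := by simpa [hκ] using hη
  obtain ⟨t, htη, ht⟩ : ∃ t, κ t * Real.sqrt (2 ^ d) < η ∧ 0 < t :=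
    (((hκ0.eventually (gt_mem_nhds hκ00)).filter_mono nhdsWithin_le_nhds).and
      (self_mem_nhdsWithin : Set.Ioi (0 : ℝ) ∈ 𝓝[>] 0)).exists
  obtain ⟨R, hR, hvR⟩ := hv.eventually_small ht
  -- The centre is so far out that the ball of radius 2/t around it avoids the open ball of radius R
  -- about the origin, outside which |v| ≤ t.
  set x₀ : Space d := (R + 2 / t) • stdVec j
  have hx₀ : ‖x₀‖ = R + 2 / t := by
    rw [norm_smul, (EuclideanSpace.basisFun (Fin d) ℝ).norm_eq_one, mul_one, Real.norm_of_nonneg]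
    positivity
  set a : Space d → ℂ := fun x => b (t • (x - x₀)) with ha
  have has : ContDiff ℝ ∞ a := contDiff_comp_smul_sub hbs t x₀
  set φ : Space d → ℂ := fun x => a x * planeWave k j x with hφ
  have hφs : ContDiff ℝ ∞ φ := has.mul (contDiff_planeWave k j)
  have hball : ∀ {x r}, t * ‖x - x₀‖ ≤ r ↔ x ∈ Metric.closedBall x₀ (r / t) := fun {x r} => by
    rw [mem_closedBall_iff_norm, le_div_iff₀ ht, mul_comm]
  have hφc : HasCompactSupport φ := by
    refine HasCompactSupport.intro (isCompact_closedBall x₀ (2 / t)) fun x hx => ?_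
    rw [← hball, not_le] at hx
    have := (hb0 (t • (x - x₀)) (by rwa [norm_smul, Real.norm_of_nonneg ht.le])).eq_of_nhds
    simp [hφ, ha, this]
  obtain ⟨p, hp, hp1, hp2⟩ := exists_mem_minimalGraph (m := m) hv hd hφs hφc
  have hexpr : ∀ x, schrodingerExpr m v φ x - l * φ x =
      (-((1 / (2 * m) : ℝ) : ℂ) * (t ^ 2 * (Δ b) (t • (x - x₀))
        + 2 * k * Complex.I * (t * fderiv ℝ b (t • (x - x₀)) (stdVec j)))
        + v x * b (t • (x - x₀))) * planeWave k j x := by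
    intro x
    have hkl : ((1 / (2 * m) : ℝ) : ℂ) * (k : ℂ) ^ 2 = l := by
      rw [← Complex.ofReal_pow, hk2, ← Complex.ofReal_mul]
      congr 1
      field_simp
    rw [schrodingerExpr, laplacian_mul_planeWave has, laplacian_comp_smul_sub hbs,
      fderiv_comp_smul_sub hbs, ← hkl]
    simp only [hφ, ha, Complex.real_smul, Complex.ofReal_pow]
    ring
  have hV1 : volume (Metric.closedBall x₀ (1 / t)) ≠ ⊤ := measure_closedBall_lt_top.ne
  have hV2 : volume (Metric.closedBall x₀ (2 / t)) ≠ ⊤ := measure_closedBall_lt_top.ne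
  have hVpos : 0 < volume.real (Metric.closedBall x₀ (1 / t)) :=
    ENNReal.toReal_pos (Metric.measure_closedBall_pos _ _ (by positivity)).ne' hV1
  have hV : volume.real (Metric.closedBall x₀ (2 / t))
      = 2 ^ d * volume.real (Metric.closedBall x₀ (1 / t)) := by
    rw [Measure.addHaar_real_closedBall _ _ (by positivity),
      Measure.addHaar_real_closedBall _ _ (by positivity), finrank_euclideanSpace, Fintype.card_fin,
      ← mul_assoc, ← mul_pow]
    congr 2
    ring
  have hlow : volume.real (Metric.closedBall x₀ (1 / t)) ^ (1 / 2 : ℝ) ≤ ‖p.1‖ := by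
    have h := norm_indicatorConstLp (p := 2) (E := ℂ) (c := 1)
      (hs := measurableSet_closedBall (x := x₀) (ε := 1 / t)) (hμs := hV1) two_ne_zero (by simp)
    rw [norm_one, one_mul] at h
    have h2 : ((2 : ENNReal).toReal) = 2 := rfl
    rw [h2] at h
    rw [← h]
    refine Lp.norm_le_norm_of_ae_le ?_
    filter_upwards [hp1, indicatorConstLp_coeFn (p := 2) (c := (1 : ℂ))
      (hs := measurableSet_closedBall (x := x₀) (ε := 1 / t)) (hμs := hV1)] with x h1 h3
    rw [h1, h3]
    by_cases hx : x ∈ Metric.closedBall x₀ (1 / t)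
    · have : g (t • (x - x₀)) = 1 := by
        refine g.one_of_mem_closedBall ?_
        rw [mem_closedBall_zero_iff, norm_smul, Real.norm_of_nonneg ht.le]
        exact hball.2 hx
      rw [Set.indicator_of_mem hx]
      simp [hφ, ha, hb, this, norm_planeWave]
    · rw [Set.indicator_of_notMem hx, norm_zero]
      exact norm_nonneg _
  have hup : ‖p.2 - (l : ℂ) • p.1‖ ≤
      κ t * volume.real (Metric.closedBall x₀ (2 / t)) ^ (1 / 2 : ℝ) := by
    have hκpos : 0 ≤ κ t := by
      have := (norm_nonneg _).trans (hC₁ 0)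
      have := (norm_nonneg _).trans (hC₂ 0)
      positivity
    have h := norm_indicatorConstLp (p := 2) (E := ℂ) (c := (κ t : ℂ))
      (hs := measurableSet_closedBall (x := x₀) (ε := 2 / t)) (hμs := hV2) two_ne_zero (by simp)
    rw [Complex.norm_real, Real.norm_of_nonneg hκpos] at h
    have h2 : ((2 : ENNReal).toReal) = 2 := rfl
    rw [h2] at h
    rw [← h]
    refine Lp.norm_le_norm_of_ae_le ?_
    filter_upwards [hp1, hp2, indicatorConstLp_coeFn (p := 2) (c := (κ t : ℂ))
      (hs := measurableSet_closedBall (x := x₀) (ε := 2 / t)) (hμs := hV2), Lp.coeFn_sub p.2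
      ((l : ℂ) • p.1), Lp.coeFn_smul (l : ℂ) p.1, hvR] with x h1 h2 h3 h4 h5 h6
    rw [h3, h4, Pi.sub_apply, h5, Pi.smul_apply, h1, h2, smul_eq_mul, hexpr x, norm_mul,
      norm_planeWave, mul_one]
    by_cases hx : x ∈ Metric.closedBall x₀ (2 / t)
    · rw [Set.indicator_of_mem hx, Complex.norm_real, Real.norm_of_nonneg hκpos]
      have hxR : R ≤ ‖x‖ := by
        have h7 := mem_closedBall_iff_norm.1 hx
        have h8 := norm_sub_norm_le x₀ x
        rw [hx₀, norm_sub_rev] at h8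
        linarith
      refine (norm_add_le _ _).trans (add_le_add ?_ ?_)
      · rw [norm_mul, norm_neg, Complex.norm_real, Real.norm_of_nonneg (by positivity)]
        refine mul_le_mul_of_nonneg_left ((norm_add_le _ _).trans (add_le_add ?_ ?_))
          (by positivity)
        · rw [norm_mul, norm_pow, Complex.norm_real, Real.norm_of_nonneg ht.le]
          exact mul_le_mul_of_nonneg_left (hC₂ _) (by positivity)
        · rw [norm_mul, norm_mul, norm_mul, norm_mul, Complex.norm_I, Complex.norm_real,
            Complex.norm_real, Real.norm_of_nonneg ht.le, Real.norm_of_nonneg (Real.sqrt_nonneg _)]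
          simp only [RCLike.norm_ofNat, mul_one]
          have := hC₁ (t • (x - x₀))
          gcongr
      · rw [norm_mul, Complex.norm_real, Real.norm_eq_abs]
        calc |v x| * ‖b (t • (x - x₀))‖ ≤ t * 1 :=
              mul_le_mul (h6 hxR) (hb1 _) (norm_nonneg _) ht.le
          _ = t := mul_one t
    · rw [Set.indicator_of_notMem hx, norm_zero]
      rw [← hball, not_le] at hx
      have h7 := hb0 (t • (x - x₀)) (by rwa [norm_smul, Real.norm_of_nonneg ht.le])
      have h8 : (Δ b) (t • (x - x₀)) = 0 := by
        rw [(laplacian_congr_nhds h7).eq_of_nhds]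
        exact congrFun (laplacian_const (E := Space d) (c := (0 : ℂ))) _
      have h9 : fderiv ℝ b (t • (x - x₀)) = 0 := by
        rw [h7.fderiv_eq]
        simp
      simp [h7.eq_of_nhds, h8, h9]
  refine ⟨p, hp, lt_of_lt_of_le (Real.rpow_pos_of_pos hVpos _) hlow, hup.trans ?_⟩
  rw [hV, Real.mul_rpow (by positivity) hVpos.le, ← Real.sqrt_eq_rpow, ← mul_assoc]
  exact mul_le_mul htη.le hlow (Real.rpow_nonneg hVpos.le _) hη.le

/-- Weyl's criterion: a bounded inverse of A - l is incompatible with approximate eigenvectors of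
arbitrarily small relative residual. The tolerance 1/(‖R‖ + 1) avoids a separate case ‖R‖ = 0. -/
theorem mem_unboundedSpectrum_of_nonneg {m : ℝ} (hm : 0 < m) {v : Space d → ℝ}
    (hv : IsShortRange v) (hd : 2 ≤ d) {l : ℝ} (hl : 0 ≤ l) :
    (l : ℂ) ∈ unboundedSpectrum (schrodingerOperator m v) := by
  rintro ⟨R, -, hR⟩
  obtain ⟨p, hp, hp0, hpη⟩ := exists_approximate_eigenfunction hm hv hd hl
    (η := 1 / (‖R‖ + 1)) (by positivity)
  obtain ⟨y, hy1, hy2⟩ := (LinearPMap.mem_graph_iff _).1 (minimalGraph_le_graph m v hp)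
  have h1 := hR y
  rw [hy1, hy2] at h1
  have h2 := R.le_opNorm (p.2 - (l : ℂ) • p.1)
  rw [h1] at h2
  have h3 : ‖R‖ * ‖p.2 - (l : ℂ) • p.1‖ ≤ ‖R‖ * (1 / (‖R‖ + 1) * ‖p.1‖) :=
    mul_le_mul_of_nonneg_left hpη (norm_nonneg _)
  have h4 : ‖p.1‖ * (‖R‖ + 1) ≤ ‖R‖ * ‖p.1‖ := by
    have := h2.trans h3
    rw [show ‖R‖ * (1 / (‖R‖ + 1) * ‖p.1‖) = ‖R‖ * ‖p.1‖ / (‖R‖ + 1) by ring,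
      le_div_iff₀ (by positivity)] at this
    exact this
  linarith

/-- If the discrete spectrum is not empty, the energy of some test function is negative. -/
theorem exists_energy_neg {m : ℝ} (hm : 0 < m) {v : Space d → ℝ} (hv : IsShortRange v)
    (hd : 2 ≤ d) (h : (discreteSpectrum (schrodingerOperator m v)).Nonempty) :
    ∃ φ, IsTest φ ∧ energy m v φ φ < 0 := by
  by_contra! hpos
  obtain ⟨z, -, ⟨r, hr, hiso⟩, hne, -⟩ := h
  obtain ⟨x, hx, hx0⟩ := Submodule.exists_mem_ne_zero_of_ne_bot hne
  have hAx : schrodingerOperator m v x = z • (x : L2 d) := by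
    have : schrodingerOperator m v x - z • (x : L2 d) = 0 := hx
    exact sub_eq_zero.1 this
  -- A real, nonnegative quadratic form is a closed condition on the graph, so it survives the
  -- closure; self-adjointness is not needed to see that z is real and nonnegative.
  have hcl : IsClosed {p : L2 d × L2 d | 0 ≤ (inner ℂ p.2 p.1).re ∧ (inner ℂ p.2 p.1).im = 0} := by
    have hc : Continuous fun p : L2 d × L2 d => inner ℂ p.2 p.1 :=
      continuous_snd.inner continuous_fst
    exact (isClosed_le continuous_const (Complex.continuous_re.comp hc)).inter
      (isClosed_eq (Complex.continuous_im.comp hc) continuous_const)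
  have hsub : (minimalGraph m v : Set (L2 d × L2 d)) ⊆
      {p : L2 d × L2 d | 0 ≤ (inner ℂ p.2 p.1).re ∧ (inner ℂ p.2 p.1).im = 0} := by
    rintro p ⟨φ, hφ, hc, h1, h2⟩
    have h3 := inner_of_mem_minimalGraph (hv.locallyIntegrable (by omega)) hφ hc h1 h2
    rw [Set.mem_ofPred_eq, h3, Complex.ofReal_re, Complex.ofReal_im]
    exact ⟨add_nonneg (hpos _ (IsTest.re hφ hc)) (hpos _ (IsTest.im hφ hc)), rfl⟩
  have hmem := closure_minimal hsub hcl (mem_closure_minimalGraph m v x)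
  have hxpos : 0 < ‖(x : L2 d)‖ ^ 2 := by
    have : (x : L2 d) ≠ 0 := fun h0 => hx0 (Subtype.ext h0)
    positivity
  have hin : inner ℂ (schrodingerOperator m v x) (x : L2 d) =
      (starRingEnd ℂ) z * ((‖(x : L2 d)‖ ^ 2 : ℝ) : ℂ) := by
    rw [hAx, inner_smul_left, inner_self_eq_norm_sq_to_K]
    simp
  rw [Set.mem_ofPred_eq, hin, Complex.re_mul_ofReal, Complex.im_mul_ofReal, Complex.conj_re,
    Complex.conj_im] at hmem
  have hzre : 0 ≤ z.re := nonneg_of_mul_nonneg_left hmem.1 hxpos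
  have hzim : z.im = 0 := by
    rcases mul_eq_zero.1 hmem.2 with h0 | h0
    · linarith
    · exact absurd h0 hxpos.ne'
  -- A second spectral point inside the disc that should isolate z.
  have hspec := mem_unboundedSpectrum_of_nonneg hm hv hd (l := z.re + r / 2) (by linarith)
  have hz : ((z.re + r / 2 : ℝ) : ℂ) - z = ((r / 2 : ℝ) : ℂ) := by
    apply Complex.ext <;> simp [hzim]
  have heq := hiso _ hspec (by
    rw [hz, Complex.norm_real, Real.norm_of_nonneg (by linarith)]
    linarith)
  rw [heq, sub_self] at hz
  have := Complex.ofReal_eq_zero.1 hz.symm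
  linarith

/-! ### Sobolev and Hölder bounds for the potential energy -/

/-- A short-range potential lies in `L^{d/2}`. -/
theorem IsShortRange.memLp_half {v : Space d → ℝ} (hv : IsShortRange v) (hd : 1 ≤ d) :
    MemLp v (ENNReal.ofReal (d / 2)) (volume : Measure (Space d)) := by
  obtain ⟨C, γ, b, hγ, hb, h⟩ := hv.decay
  have hd' : (1 : ℝ) ≤ d := by exact_mod_cast hd
  have hp : ENNReal.ofReal (d / 2) ≤ d := by
    rw [← ENNReal.ofReal_natCast]
    exact ENNReal.ofReal_le_ofReal (by linarith)
  set S : Set (Space d) := Metric.closedBall 0 γ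
  have hS : MeasurableSet S := measurableSet_closedBall
  have h1 : MemLp (S.indicator v) (ENNReal.ofReal (d / 2)) (volume : Measure (Space d)) :=
    (memLp_indicator_iff_restrict hS).2 (hv.memLp_ball hp (isCompact_closedBall 0 γ))
  have h2 : MemLp (fun x : Space d => (1 + ‖x‖) ^ (-b)) (ENNReal.ofReal (d / 2)) volume := by
    have hc : Continuous fun x : Space d => (1 + ‖x‖) ^ (-b) :=
      (continuous_const.add continuous_norm).rpow_const fun x =>
        Or.inl (show (0 : ℝ) < 1 + ‖x‖ by positivity).ne'
    refine (integrable_norm_rpow_iff hc.aestronglyMeasurable (by simp; omega)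
      ENNReal.ofReal_ne_top).1 ?_
    rw [ENNReal.toReal_ofReal (by positivity)]
    -- This is where b > 2 enters: |x|^{-b} to the power d/2 is integrable at infinity.
    have hr : (Module.finrank ℝ (Space d) : ℝ) < b * (d / 2) := by
      rw [finrank_euclideanSpace, Fintype.card_fin]
      nlinarith
    refine (integrable_one_add_norm (μ := (volume : Measure (Space d))) hr).congr
      (.of_forall fun x => ?_)
    have h0 : 0 ≤ 1 + ‖x‖ := by positivity
    simp only
    rw [Real.norm_of_nonneg (Real.rpow_nonneg h0 _), ← Real.rpow_mul h0]
    ring_nf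
  have h3 : MemLp (Sᶜ.indicator v) (ENNReal.ofReal (d / 2)) (volume : Measure (Space d)) := by
    -- The constant comes from 1 + |x| ≤ (1 + 1/γ)|x| for |x| ≥ γ.
    refine MemLp.of_le_mul (c := |C| * (1 + 1 / γ) ^ b) h2
      ((hv.aestronglyMeasurable hd).indicator hS.compl) ?_
    filter_upwards [h] with x hx
    have h0 : 0 < 1 + ‖x‖ := by positivity
    have hK : 0 < 1 + 1 / γ := by positivity
    by_cases hxS : x ∈ S
    · rw [Set.indicator_of_notMem (by simpa using hxS), norm_zero]
      positivity
    · rw [Set.indicator_of_mem (show x ∈ Sᶜ from hxS), Real.norm_eq_abs,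
        Real.norm_of_nonneg (Real.rpow_nonneg h0.le _)]
      have hγx : γ < ‖x‖ := by simpa [S] using hxS
      have hxpos : 0 < ‖x‖ := hγ.trans hγx
      have hdiv : (1 + ‖x‖) / (1 + 1 / γ) ≤ ‖x‖ := by
        rw [div_le_iff₀ hK]
        have : 1 ≤ ‖x‖ * (1 / γ) := by
          rw [mul_one_div, le_div_iff₀ hγ]
          linarith
        linarith
      calc |v x| ≤ C * ‖x‖ ^ (-b) := hx hγx.le
        _ ≤ |C| * ‖x‖ ^ (-b) :=
            mul_le_mul_of_nonneg_right (le_abs_self C) (Real.rpow_nonneg hxpos.le _)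
        _ ≤ |C| * ((1 + ‖x‖) / (1 + 1 / γ)) ^ (-b) :=
            mul_le_mul_of_nonneg_left
              (Real.rpow_le_rpow_of_nonpos (div_pos h0 hK) hdiv (by linarith)) (abs_nonneg C)
        _ = |C| * (1 + 1 / γ) ^ b * (1 + ‖x‖) ^ (-b) := by
            rw [Real.div_rpow h0.le hK.le, Real.rpow_neg hK.le b]
            field_simp
  have h4 := h1.add h3
  rwa [Set.indicator_self_add_compl] at h4

/-- The Sobolev inequality for test functions. -/
theorem exists_sobolev_bound (hd : 3 ≤ d) : ∃ C : NNReal, ∀ u : Space d → ℝ, IsTest u →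
    eLpNorm u (ENNReal.ofReal (2 * d / (d - 2))) volume ≤ C * eLpNorm (gradient u) 2 volume := by
  refine ⟨eLpNormLESNormFDerivOfEqInnerConst (volume : Measure (Space d)) 2, fun u hu => ?_⟩
  have hd' : (3 : ℝ) ≤ d := by exact_mod_cast hd
  have h := eLpNorm_le_eLpNorm_fderiv_of_eq_inner (μ := (volume : Measure (Space d)))
    (p := 2) (p' := (2 * d / (d - 2) : ℝ).toNNReal) (hu.smooth.of_le (by simp)) hu.compact
    (by norm_num) (by rw [finrank_euclideanSpace, Fintype.card_fin]; omega) (by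
      rw [finrank_euclideanSpace, Fintype.card_fin, Real.coe_toNNReal]
      · have : (d : ℝ) - 2 ≠ 0 := by linarith
        push_cast
        field_simp
      · exact div_nonneg (by linarith) (by linarith))
  have h2 : eLpNorm (fderiv ℝ u) 2 volume = eLpNorm (gradient u) 2 volume :=
    eLpNorm_congr_norm_ae (.of_forall fun x => (norm_gradient u x).symm)
  rw [← h2]
  exact h

/-- Hölder's inequality for the potential energy. -/
theorem lintegral_mul_sq_le {v u : Space d → ℝ} (hd : 3 ≤ d)
    (hv : AEStronglyMeasurable v volume) (hu : AEStronglyMeasurable u volume) :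
    ∫⁻ x, ‖v x‖ₑ * ‖u x‖ₑ ^ 2 ≤ eLpNorm v (ENNReal.ofReal (d / 2)) volume *
      eLpNorm u (ENNReal.ofReal (2 * d / (d - 2))) volume ^ 2 := by
  have hd' : (3 : ℝ) ≤ d := by exact_mod_cast hd
  have hd2 : (0 : ℝ) < d - 2 := by linarith
  have hd0 : (0 : ℝ) < d := by linarith
  -- The square of u lies in L^{d/(d-2)} exactly when u lies in L^{2d/(d-2)}.
  have hpq : ((d : ℝ) / 2).HolderConjugate (d / (d - 2)) := by
    rw [Real.holderConjugate_iff]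
    constructor
    · linarith
    · field_simp
      ring
  refine (ENNReal.lintegral_mul_le_Lp_mul_Lq volume hpq hv.enorm (hu.enorm.pow_const 2)).trans_eq ?_
  rw [eLpNorm_eq_lintegral_rpow_enorm_toReal (by simp; omega) ENNReal.ofReal_ne_top,
    eLpNorm_eq_lintegral_rpow_enorm_toReal (by
      simp only [ne_eq, ENNReal.ofReal_eq_zero, not_le]; positivity) ENNReal.ofReal_ne_top,
    ENNReal.toReal_ofReal (by positivity), ENNReal.toReal_ofReal (by positivity),
    ← ENNReal.rpow_natCast, ← ENNReal.rpow_mul]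
  congr 2
  · refine lintegral_congr fun x => ?_
    rw [← ENNReal.rpow_natCast, ← ENNReal.rpow_mul]
    congr 1
    push_cast
    ring
  · push_cast
    field_simp

theorem eLpNorm_two_sq {E : Type*} [NormedAddCommGroup E] {α : Type*} [MeasurableSpace α]
    (μ : Measure α) (f : α → E) : eLpNorm f 2 μ ^ 2 = ∫⁻ x, ‖f x‖ₑ ^ 2 ∂μ := by
  have := eLpNorm_nnreal_pow_eq_lintegral (μ := μ) (f := f) (p := 2) two_ne_zero
  simpa using this

theorem lintegral_gradient_sq {u : Space d → ℝ} (hu : IsTest u) :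
    ∫⁻ x, ‖gradient u x‖ₑ ^ 2 = ENNReal.ofReal (∫ x, ‖gradient u x‖ ^ 2) := by
  rw [ofReal_integral_eq_lintegral_ofReal ((hu.memLp_gradient 2).integrable_norm_pow (by simp))
    (.of_forall fun x => by positivity)]
  refine lintegral_congr fun x => ?_
  rw [ENNReal.ofReal_pow (norm_nonneg _), ofReal_norm]

/-! ### Nonnegative minimizing sequences -/

/-- Smooth approximation of the absolute value that vanishes at `0`. -/
def smoothAbs (δ s : ℝ) : ℝ := Real.sqrt (s ^ 2 + δ ^ 2) - δ

section SmoothAbs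

variable {δ : ℝ}

theorem contDiff_smoothAbs (hδ : 0 < δ) : ContDiff ℝ ∞ (smoothAbs δ) := by
  refine ContDiff.sub (ContDiff.sqrt (by fun_prop) fun s => ?_) contDiff_const
  positivity

theorem hasDerivAt_smoothAbs (hδ : 0 < δ) (s : ℝ) :
    HasDerivAt (smoothAbs δ) (s / Real.sqrt (s ^ 2 + δ ^ 2)) s := by
  have h1 : HasDerivAt (fun s : ℝ => s ^ 2 + δ ^ 2) (2 * s) s := by
    simpa using (hasDerivAt_pow 2 s).add_const (δ ^ 2)
  have h2 := (h1.sqrt (by positivity)).sub_const δ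
  rwa [mul_div_mul_left _ _ two_ne_zero] at h2

theorem abs_div_sqrt_le_one (hδ : 0 < δ) (s : ℝ) : |s / Real.sqrt (s ^ 2 + δ ^ 2)| ≤ 1 := by
  rw [abs_div, abs_of_nonneg (Real.sqrt_nonneg _), div_le_one (by positivity)]
  exact Real.abs_le_sqrt (by nlinarith)

theorem smoothAbs_zero (hδ : 0 < δ) : smoothAbs δ 0 = 0 := by
  simp [smoothAbs, Real.sqrt_sq hδ.le]

theorem smoothAbs_nonneg (δ s : ℝ) : 0 ≤ smoothAbs δ s := by
  rw [smoothAbs, sub_nonneg]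
  exact Real.le_sqrt_of_sq_le (by nlinarith)

theorem smoothAbs_le (hδ : 0 < δ) (s : ℝ) : smoothAbs δ s ≤ |s| := by
  rw [smoothAbs, sub_le_iff_le_add, Real.sqrt_le_left (by positivity), add_sq, sq_abs]
  have := mul_nonneg (abs_nonneg s) hδ.le
  linarith

theorem tendsto_smoothAbs (s : ℝ) : Tendsto (fun δ => smoothAbs δ s) (𝓝 0) (𝓝 |s|) := by
  have : Continuous fun δ : ℝ => smoothAbs δ s := by unfold smoothAbs; fun_prop
  simpa [smoothAbs, Real.sqrt_sq_eq_abs] using this.tendsto 0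

end SmoothAbs

/-- The function |φ| need not be smooth, so it is replaced by `smoothAbs δ` of φ. The derivative of
`smoothAbs δ` is bounded by 1, so the kinetic energy does not grow; the potential energy converges
by dominated convergence, and the strict inequality survives for small δ. -/
theorem exists_nonneg_energy_neg {m : ℝ} (hm : 0 < m) {v φ : Space d → ℝ}
    (hv : LocallyIntegrable v (volume : Measure (Space d))) (hφ : IsTest φ)
    (hneg : energy m v φ φ < 0) :
    ∃ ψ, IsTest ψ ∧ (∀ x, 0 ≤ ψ x) ∧ energy m v ψ ψ < 0 := by
  set δ : ℕ → ℝ := fun n => 1 / ((n : ℝ) + 1) with hδdef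
  have hδ : ∀ n, 0 < δ n := fun n => Nat.one_div_pos_of_nat
  set ψ : ℕ → Space d → ℝ := fun n x => smoothAbs (δ n) (φ x) with hψdef
  have hψ : ∀ n, IsTest (ψ n) := fun n =>
    hφ.comp (fun x => (contDiff_smoothAbs (hδ n)).contDiffAt) (smoothAbs_zero (hδ n))
  have hgrad : ∀ n, ∫ x, ‖gradient (ψ n) x‖ ^ 2 ≤ ∫ x, ‖gradient φ x‖ ^ 2 := fun n => by
    refine integral_mono (((hψ n).memLp_gradient 2).integrable_norm_pow (by simp))
      ((hφ.memLp_gradient 2).integrable_norm_pow (by simp)) fun x => ?_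
    simp only
    rw [hψdef, gradient_comp_deriv (hasDerivAt_smoothAbs (hδ n) (φ x)) (hφ.differentiableAt x),
      norm_smul]
    have h1 := abs_div_sqrt_le_one (hδ n) (φ x)
    have h2 := norm_nonneg (gradient φ x)
    rw [Real.norm_eq_abs]
    gcongr
    exact mul_le_of_le_one_left h2 h1
  have hlim : Tendsto (fun n => ∫ x, v x * ψ n x ^ 2) atTop (𝓝 (∫ x, v x * φ x ^ 2)) := by
    have hint : Integrable fun x => v x * (φ x * φ x) :=
      (hφ.mul_smooth hφ.smooth).integrable_mul hv
    refine tendsto_integral_of_dominated_convergence (fun x => ‖v x * (φ x * φ x)‖) (fun n => ?_)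
      hint.norm (fun n => .of_forall fun x => ?_) (.of_forall fun x => ?_)
    · exact hv.aestronglyMeasurable.mul ((hψ n).continuous.pow 2).aestronglyMeasurable
    · rw [norm_mul, norm_mul]
      refine mul_le_mul_of_nonneg_left ?_ (norm_nonneg _)
      rw [norm_pow, norm_mul, ← pow_two, Real.norm_eq_abs, Real.norm_eq_abs,
        abs_of_nonneg (smoothAbs_nonneg _ _)]
      exact pow_le_pow_left₀ (smoothAbs_nonneg _ _) (smoothAbs_le (hδ n) _) 2
    · have h := (((tendsto_smoothAbs (φ x)).comp
        (tendsto_one_div_add_atTop_nhds_zero_nat (𝕜 := ℝ))).pow 2).const_mul (v x)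
      rw [sq_abs] at h
      exact h
  rw [energy_self_eq hv hφ] at hneg
  have hev : ∀ᶠ n in atTop, ∫ x, v x * ψ n x ^ 2 < -((1 / (2 * m)) * ∫ x, ‖gradient φ x‖ ^ 2) :=
    hlim.eventually (gt_mem_nhds (by linarith))
  obtain ⟨n, hn⟩ := hev.exists
  refine ⟨ψ n, hψ n, fun x => smoothAbs_nonneg _ _, ?_⟩
  rw [energy_self_eq hv (hψ n)]
  have := mul_le_mul_of_nonneg_left (hgrad n) (show 0 ≤ 1 / (2 * m) by positivity)
  linarith

/-- With c = 1/(2m), kinetic integral D and potential energy q, the inequality cD + (1+ε)q < 0 gives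
cD + q < -εq, and cD + q ≥ 0 gives -q ≤ cD; hence the energy is below εcD. The case D = 0 is
excluded, since it would force both q ≥ 0 and q < 0. -/
theorem exists_normalized_energy_lt {m : ℝ} (hm : 0 < m) {v ψ : Space d → ℝ} {ε : ℝ} (hε : 0 < ε)
    (hv : LocallyIntegrable v (volume : Measure (Space d)))
    (hpos : ∀ φ, IsTest φ → 0 ≤ energy m v φ φ) (hψ : IsTest ψ) (hψ0 : ∀ x, 0 ≤ ψ x)
    (hneg : energy m (fun x => (1 + ε) * v x) ψ ψ < 0) :
    ∃ χ, IsTest χ ∧ (∀ x, 0 ≤ χ x) ∧ ∫ x, ‖gradient χ x‖ ^ 2 = 1 ∧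
      energy m v χ χ ≤ 1 / (2 * m) * ε := by
  have hv' : LocallyIntegrable (fun x => (1 + ε) * v x) (volume : Measure (Space d)) :=
    hv.smul (1 + ε)
  have h1 := hpos ψ hψ
  rw [energy_self_eq hv hψ] at h1
  rw [energy_self_eq hv' hψ] at hneg
  simp_rw [mul_assoc (1 + ε)] at hneg
  rw [integral_const_mul] at hneg
  set D := ∫ x, ‖gradient ψ x‖ ^ 2 with hD
  set q := ∫ x, v x * ψ x ^ 2 with hq
  have hD0 : 0 ≤ D := integral_nonneg fun x => by positivity
  have hm' : 0 < 1 / (2 * m) := by positivity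
  have hcD : 0 ≤ 1 / (2 * m) * D := by positivity
  have hDpos : 0 < D := by
    rcases hD0.lt_or_eq with h | h
    · exact h
    · rw [← h] at h1 hneg
      nlinarith
  set s : ℝ := (Real.sqrt D)⁻¹ with hs
  have hs2 : s ^ 2 = D⁻¹ := by rw [hs, inv_pow, Real.sq_sqrt hD0]
  refine ⟨fun x => s * ψ x, hψ.const_mul s, fun x => mul_nonneg (by positivity) (hψ0 x), ?_, ?_⟩
  · have : ∀ x, ‖gradient (fun y => s * ψ y) x‖ ^ 2 = s ^ 2 * ‖gradient ψ x‖ ^ 2 := fun x => by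
      rw [gradient_const_mul s (hψ.differentiableAt x), norm_smul, mul_pow, Real.norm_eq_abs,
        sq_abs]
    simp_rw [this]
    rw [integral_const_mul, ← hD, hs2, inv_mul_cancel₀ hDpos.ne']
  · rw [energy_const_mul_self s hψ, energy_self_eq hv hψ, ← hD, ← hq, hs2, inv_mul_le_iff₀ hDpos]
    have : q ≤ 0 := by nlinarith
    nlinarith

/-- A virtual level provides a nonnegative minimizing sequence. -/
theorem exists_minimizing_sequence {m : ℝ} (hm : 0 < m) {v : Space d → ℝ} (hd : 2 ≤ d)
    (hv : IsShortRange v) (hlevel : HasVirtualLevel m v) :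
    ∃ ψ : ℕ → Space d → ℝ, (∀ n, IsTest (ψ n)) ∧ (∀ n x, 0 ≤ ψ n x) ∧
      (∀ n, ∫ x, ‖gradient (ψ n) x‖ ^ 2 = 1) ∧
      Tendsto (fun n => energy m v (ψ n) (ψ n)) atTop (𝓝 0) := by
  have hpos : ∀ φ, IsTest φ → 0 ≤ energy m v φ φ := fun φ hφ =>
    energy_nonneg_of_isNonneg hv hd hlevel.1 hφ
  have hex : ∀ n : ℕ, ∃ χ, IsTest χ ∧ (∀ x, 0 ≤ χ x) ∧ ∫ x, ‖gradient χ x‖ ^ 2 = 1 ∧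
      energy m v χ χ ≤ 1 / (2 * m) * (1 / ((n : ℝ) + 1)) := fun n => by
    have hn : (0 : ℝ) < 1 / ((n : ℝ) + 1) := Nat.one_div_pos_of_nat
    have hv' := hv.const_mul (1 + 1 / ((n : ℝ) + 1))
    obtain ⟨φ, hφ, hφneg⟩ := exists_energy_neg hm hv' hd (hlevel.2 _ hn)
    obtain ⟨ψ, hψ, hψ0, hψneg⟩ :=
      exists_nonneg_energy_neg hm (hv'.locallyIntegrable (by omega)) hφ hφneg
    exact exists_normalized_energy_lt hm hn (hv.locallyIntegrable (by omega)) hpos hψ hψ0 hψneg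
  choose ψ h1 h2 h3 h4 using hex
  refine ⟨ψ, h1, h2, h3, squeeze_zero (fun n => hpos _ (h1 n)) h4 ?_⟩
  simpa using (tendsto_one_div_add_atTop_nhds_zero_nat (𝕜 := ℝ)).const_mul (1 / (2 * m))

/-! ### A Poincaré inequality on convex sets -/

theorem real_enorm_sq (s : ℝ) : ‖s‖ₑ ^ 2 = ENNReal.ofReal (s ^ 2) := by
  rw [← ofReal_norm, ← ENNReal.ofReal_pow (norm_nonneg _), Real.norm_eq_abs, sq_abs]

theorem sq_lintegral_enorm_le {α E : Type*} [MeasurableSpace α] [NormedAddCommGroup E]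
    {μ : Measure α} [IsProbabilityMeasure μ] {f : α → E} (hf : AEStronglyMeasurable f μ) :
    (∫⁻ x, ‖f x‖ₑ ∂μ) ^ 2 ≤ ∫⁻ x, ‖f x‖ₑ ^ 2 ∂μ := by
  rw [← eLpNorm_two_sq, ← eLpNorm_one_eq_lintegral_enorm]
  exact pow_le_pow_left' (eLpNorm_le_eLpNorm_of_exponent_le one_le_two hf) 2

/-- The fundamental theorem of calculus along the segment, followed by Cauchy–Schwarz in t on the
unit interval. -/
theorem enorm_sub_sq_le_lintegral_segment {w : Space d → ℝ} (hw : ContDiff ℝ ∞ w)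
    (x e : Space d) : ‖w (x + e) - w x‖ₑ ^ 2 ≤
      ‖e‖ₑ ^ 2 * ∫⁻ t in Set.Ioc (0 : ℝ) 1, ‖gradient w (x + t • e)‖ₑ ^ 2 := by
  have hc : Continuous fun t : ℝ => gradient w (x + t • e) :=
    (continuous_gradient hw).comp (by fun_prop)
  have hd' : ∀ t : ℝ, HasDerivAt (fun t : ℝ => w (x + t • e))
      (inner ℝ (gradient w (x + t • e)) e) t := fun t => by
    have h1 : HasDerivAt (fun t : ℝ => x + t • e) e t := by
      simpa using ((hasDerivAt_id t).smul_const e).const_add x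
    have h2 := ((hw.differentiable (by simp) (x + t • e)).hasFDerivAt).comp_hasDerivAt t h1
    rwa [← inner_gradient_left] at h2
  have hftc : w (x + e) - w x = ∫ t in Set.Ioc (0 : ℝ) 1, inner ℝ (gradient w (x + t • e)) e := by
    have := intervalIntegral.integral_eq_sub_of_hasDerivAt (a := 0) (b := 1)
      (fun t _ => hd' t) ((hc.inner continuous_const).intervalIntegrable _ _)
    rw [intervalIntegral.integral_of_le zero_le_one] at this
    simpa using this.symm
  have : IsProbabilityMeasure ((volume : Measure ℝ).restrict (Set.Ioc 0 1)) := ⟨by simp⟩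
  have hle : ‖w (x + e) - w x‖ₑ ≤
      ‖e‖ₑ * ∫⁻ t in Set.Ioc (0 : ℝ) 1, ‖gradient w (x + t • e)‖ₑ := by
    rw [hftc, ← lintegral_const_mul _ hc.enorm.measurable]
    refine (enorm_integral_le_lintegral_enorm _).trans (lintegral_mono fun t => ?_)
    have := norm_inner_le_norm (𝕜 := ℝ) (gradient w (x + t • e)) e
    rw [mul_comm]
    simp only [← ofReal_norm, ← ENNReal.ofReal_mul (norm_nonneg _)]
    exact ENNReal.ofReal_le_ofReal this
  calc ‖w (x + e) - w x‖ₑ ^ 2 ≤ (‖e‖ₑ * ∫⁻ t in Set.Ioc (0 : ℝ) 1, ‖gradient w (x + t • e)‖ₑ) ^ 2 :=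
        pow_le_pow_left' hle 2
    _ ≤ _ := by
        rw [mul_pow]
        gcongr
        exact sq_lintegral_enorm_le hc.aestronglyMeasurable

theorem lintegral_comp_smul_add {F : Space d → ENNReal} (hF : Measurable F) {a : ℝ}
    (ha : 1 / 2 ≤ a) (z : Space d) : ∫⁻ x, F (a • x + z) ≤ 2 ^ d * ∫⁻ x, F x := by
  have ha0 : 0 < a := by linarith
  have hF' : Measurable fun y => F (y + z) := hF.comp (measurable_add_const z)
  have h1 : ∫⁻ x, F (a • x + z) = ∫⁻ y, F (y + z) ∂(Measure.map (a • ·) volume) :=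
    (lintegral_map hF' (measurable_const_smul a)).symm
  rw [h1, Measure.map_addHaar_smul _ ha0.ne', lintegral_smul_measure,
    lintegral_add_right_eq_self F z, finrank_euclideanSpace, Fintype.card_fin, smul_eq_mul]
  gcongr
  have h2 : |(a ^ d)⁻¹| ≤ 2 ^ d := by
    rw [abs_of_pos (by positivity), ← inv_pow]
    refine pow_le_pow_left₀ (by positivity) ?_ d
    rw [inv_le_comm₀ ha0 two_pos]
    linarith
  calc ENNReal.ofReal |(a ^ d)⁻¹| ≤ ENNReal.ofReal (2 ^ d) := ENNReal.ofReal_le_ofReal h2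
    _ = 2 ^ d := by rw [ENNReal.ofReal_pow two_pos.le]; simp

/-- Poincaré's inequality on a convex set of diameter at most `D`, with the mean oscillation on the
left-hand side. -/
theorem poincare_convex {w : Space d → ℝ} (hw : ContDiff ℝ ∞ w) {S : Set (Space d)}
    (hS : Convex ℝ S) (hSm : MeasurableSet S) {D : ENNReal}
    (hD : ∀ x ∈ S, ∀ y ∈ S, ‖x - y‖ₑ ≤ D) :
    ∫⁻ x in S, ∫⁻ y in S, ‖w x - w y‖ₑ ^ 2 ≤
      4 * 2 ^ d * D ^ 2 * volume S * ∫⁻ x in S, ‖gradient w x‖ₑ ^ 2 := by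
  set g : Space d → ENNReal := S.indicator fun z => ‖gradient w z‖ₑ ^ 2 with hg
  have hgm : Measurable g :=
    ((continuous_gradient hw).enorm.measurable.pow_const 2).indicator hSm
  -- Only the half-segment from x to the midpoint is used. Along it x has coefficient 1 - t/2 ≥ 1/2,
  -- so the change of variables in x never degenerates and costs at most 2^d.
  set P : Space d → Space d → ℝ → Space d := fun x y t => x + t • ((1 / 2 : ℝ) • (y - x)) with hP
  set K : Space d → Space d → ENNReal := fun x y => ∫⁻ t in Set.Ioc (0 : ℝ) 1, g (P x y t) with hK
  have hPm : Continuous fun q : (Space d × Space d) × ℝ => P q.1.1 q.1.2 q.2 := by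
    simp only [hP]
    fun_prop
  have hKm : Measurable fun q : Space d × Space d => K q.1 q.2 :=
    Measurable.lintegral_prod_right' (hgm.comp hPm.measurable)
  have hone : ∀ x ∈ S, ∀ y ∈ S, ‖w (x + (1 / 2 : ℝ) • (y - x)) - w x‖ₑ ^ 2 ≤ D ^ 2 * K x y := by
    intro x hx y hy
    refine (enorm_sub_sq_le_lintegral_segment hw x _).trans ?_
    have h1 : ‖(1 / 2 : ℝ) • (y - x)‖ₑ ≤ D := by
      refine le_trans ?_ (hD y hy x hx)
      rw [← ofReal_norm, ← ofReal_norm, norm_smul]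
      refine ENNReal.ofReal_le_ofReal (mul_le_of_le_one_left (norm_nonneg _) ?_)
      norm_num
    gcongr
    refine setLIntegral_mono' measurableSet_Ioc fun t ht => ?_
    have hmem : P x y t ∈ S := by
      have : P x y t = (1 - t / 2) • x + (t / 2) • y := by
        simp only [hP]
        module
      rw [this]
      exact hS hx hy (by linarith [ht.2]) (by linarith [ht.1]) (by ring)
    rw [hg, Set.indicator_of_mem hmem]
  have hpt : ∀ x ∈ S, ∀ y ∈ S, ‖w x - w y‖ₑ ^ 2 ≤ 2 * D ^ 2 * (K x y + K y x) := by
    intro x hx y hy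
    have hmid : y + (1 / 2 : ℝ) • (x - y) = x + (1 / 2 : ℝ) • (y - x) := by module
    have h1 := hone x hx y hy
    have h2 := hone y hy x hx
    rw [hmid] at h2
    -- Both w(x) and w(y) are compared with the value at the common midpoint.
    set q := w (x + (1 / 2 : ℝ) • (y - x))
    have h3 : ‖w x - w y‖ₑ ^ 2 ≤ 2 * (‖q - w x‖ₑ ^ 2 + ‖q - w y‖ₑ ^ 2) := by
      rw [real_enorm_sq, real_enorm_sq, real_enorm_sq,
        ← ENNReal.ofReal_add (by positivity) (by positivity), ← ENNReal.ofReal_ofNat 2,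
        ← ENNReal.ofReal_mul (by positivity)]
      refine ENNReal.ofReal_le_ofReal ?_
      nlinarith [sq_nonneg (2 * q - w x - w y)]
    calc ‖w x - w y‖ₑ ^ 2 ≤ 2 * (‖q - w x‖ₑ ^ 2 + ‖q - w y‖ₑ ^ 2) := h3
      _ ≤ 2 * (D ^ 2 * K x y + D ^ 2 * K y x) := by gcongr
      _ = 2 * D ^ 2 * (K x y + K y x) := by ring
  have hKint : ∫⁻ y in S, ∫⁻ x in S, K x y ≤ volume S * (2 ^ d * ∫⁻ x, g x) := by
    have h1 : ∀ y, ∫⁻ x in S, K x y ≤ 2 ^ d * ∫⁻ x, g x := by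
      intro y
      calc ∫⁻ x in S, K x y ≤ ∫⁻ x, K x y := setLIntegral_le_lintegral _ _
        _ = ∫⁻ t in Set.Ioc (0 : ℝ) 1, ∫⁻ x, g (P x y t) := by
            refine lintegral_lintegral_swap ?_
            refine (hgm.comp (hPm.comp (?_ : Continuous fun q : Space d × ℝ =>
              ((q.1, y), q.2))).measurable).aemeasurable
            fun_prop
        _ ≤ ∫⁻ t in Set.Ioc (0 : ℝ) 1, 2 ^ d * ∫⁻ x, g x := by
            refine setLIntegral_mono' measurableSet_Ioc fun t ht => ?_
            have h2 : ∀ x, P x y t = (1 - t / 2) • x + (t / 2) • y := fun x => by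
              simp only [hP]
              module
            simp_rw [h2]
            exact lintegral_comp_smul_add hgm (by linarith [ht.2]) _
        _ = 2 ^ d * ∫⁻ x, g x := by simp
    calc ∫⁻ y in S, ∫⁻ x in S, K x y ≤ ∫⁻ y in S, 2 ^ d * ∫⁻ x, g x := lintegral_mono h1
      _ = volume S * (2 ^ d * ∫⁻ x, g x) := by rw [setLIntegral_const, mul_comm]
  have hswap : ∫⁻ x in S, ∫⁻ y in S, K x y = ∫⁻ y in S, ∫⁻ x in S, K x y :=
    lintegral_lintegral_swap hKm.aemeasurable
  have hKm1 : ∀ x, Measurable fun y => K x y := fun x => hKm.comp measurable_prodMk_left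
  have hKm2 : ∀ x, Measurable fun y => K y x := fun x => hKm.comp measurable_prodMk_right
  have hgint : ∫⁻ x, g x = ∫⁻ x in S, ‖gradient w x‖ₑ ^ 2 := lintegral_indicator hSm _
  calc ∫⁻ x in S, ∫⁻ y in S, ‖w x - w y‖ₑ ^ 2
      ≤ ∫⁻ x in S, ∫⁻ y in S, 2 * D ^ 2 * (K x y + K y x) :=
        setLIntegral_mono' hSm fun x hx => setLIntegral_mono' hSm fun y hy => hpt x hx y hy
    _ = 2 * D ^ 2 * (∫⁻ x in S, ∫⁻ y in S, K x y) + 2 * D ^ 2 * ∫⁻ x in S, ∫⁻ y in S, K y x := by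
        have h1 : ∀ x, ∫⁻ y in S, 2 * D ^ 2 * (K x y + K y x) =
            2 * D ^ 2 * (∫⁻ y in S, K x y) + 2 * D ^ 2 * ∫⁻ y in S, K y x := fun x => by
          rw [lintegral_const_mul _ (f := fun y => K x y + K y x) ((hKm1 x).add (hKm2 x)),
            lintegral_add_left (hKm1 x), mul_add]
        have hm1 : Measurable fun x => ∫⁻ y in S, K x y := hKm.lintegral_prod_right'
        have hm2 : Measurable fun x => ∫⁻ y in S, K y x := hKm.lintegral_prod_left'
        simp_rw [h1]
        rw [lintegral_add_left (hm1.const_mul _), lintegral_const_mul _ hm1,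
          lintegral_const_mul _ hm2]
    _ ≤ 2 * D ^ 2 * (volume S * (2 ^ d * ∫⁻ x, g x))
        + 2 * D ^ 2 * (volume S * (2 ^ d * ∫⁻ x, g x)) := by
        rw [hswap]
        gcongr
    _ = _ := by
        rw [hgint]
        ring

/-! ### Compactness of the potential energy -/

/-- The cube of side `1 / (N + 1)` with index `k` in the standard tiling of `ℝ^d`. -/
def gridCube (N : ℕ) (k : Fin d → ℤ) : Set (Space d) :=
  {x | ∀ i, ⌊((N : ℝ) + 1) * x i⌋ = k i}

theorem gridCube_eq_iInter (N : ℕ) (k : Fin d → ℤ) : gridCube N k =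
    ⋂ i, (EuclideanSpace.proj (𝕜 := ℝ) i : Space d →L[ℝ] ℝ) ⁻¹'
      ((fun s => ((N : ℝ) + 1) * s) ⁻¹' Set.Ico (k i : ℝ) (k i + 1)) := by
  ext x
  simp [gridCube, Int.floor_eq_iff]

theorem convex_gridCube (N : ℕ) (k : Fin d → ℤ) : Convex ℝ (gridCube N k) := by
  rw [gridCube_eq_iInter]
  refine convex_iInter fun i => Convex.is_linear_preimage ?_
    (EuclideanSpace.proj (𝕜 := ℝ) i : Space d →L[ℝ] ℝ).toLinearMap.isLinear
  exact (convex_Ico _ _).is_linear_preimage (IsLinearMap.isLinearMap_smul ((N : ℝ) + 1))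

theorem measurableSet_gridCube (N : ℕ) (k : Fin d → ℤ) : MeasurableSet (gridCube N k) := by
  rw [gridCube_eq_iInter]
  refine MeasurableSet.iInter fun i => ?_
  exact ((measurable_const_mul _) measurableSet_Ico).preimage
    (EuclideanSpace.proj (𝕜 := ℝ) i : Space d →L[ℝ] ℝ).continuous.measurable

theorem norm_sub_le_of_mem_gridCube {N : ℕ} {k : Fin d → ℤ} {x y : Space d}
    (hx : x ∈ gridCube N k) (hy : y ∈ gridCube N k) : ‖x - y‖ ≤ Real.sqrt d / (N + 1) := by
  have hN : (0 : ℝ) < (N : ℝ) + 1 := by positivity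
  have h : ∀ i, ‖(x - y) i‖ ^ 2 ≤ (1 / ((N : ℝ) + 1)) ^ 2 := fun i => by
    have h1 := (Int.floor_eq_iff.1 (hx i))
    have h2 := (Int.floor_eq_iff.1 (hy i))
    refine pow_le_pow_left₀ (norm_nonneg _) ?_ 2
    have h3 : |(x i - y i) * ((N : ℝ) + 1)| ≤ 1 := by
      rw [abs_le]
      constructor <;> nlinarith
    rw [abs_mul, abs_of_pos hN] at h3
    rwa [PiLp.sub_apply, Real.norm_eq_abs, le_div_iff₀ hN]
  rw [EuclideanSpace.norm_eq]
  calc Real.sqrt (∑ i, ‖(x - y) i‖ ^ 2) ≤ Real.sqrt (∑ _i : Fin d, (1 / ((N : ℝ) + 1)) ^ 2) :=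
        Real.sqrt_le_sqrt (Finset.sum_le_sum fun i _ => h i)
    _ = Real.sqrt d / (N + 1) := by
        rw [Finset.sum_const, Finset.card_univ, Fintype.card_fin, nsmul_eq_mul,
          Real.sqrt_mul (by positivity), Real.sqrt_sq (by positivity)]
        ring

theorem volume_gridCube_lt_top (N : ℕ) (k : Fin d → ℤ) : volume (gridCube N k) < ⊤ := by
  refine Bornology.IsBounded.measure_lt_top ?_
  exact Metric.isBounded_iff.2 ⟨_, fun x hx y hy => by
    rw [dist_eq_norm]
    exact norm_sub_le_of_mem_gridCube hx hy⟩

theorem pairwiseDisjoint_gridCube (N : ℕ) (s : Set (Fin d → ℤ)) :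
    s.PairwiseDisjoint (gridCube N) := by
  intro k _ l _ hkl
  refine Set.disjoint_left.2 fun x hx hy => hkl ?_
  ext i
  rw [← hx i, hy i]

/-- Finitely many cubes cover a ball. -/
theorem exists_finset_gridCube (N : ℕ) (R : ℝ) : ∃ F : Finset (Fin d → ℤ),
    Metric.closedBall (0 : Space d) R ⊆ ⋃ k ∈ F, gridCube N k := by
  refine ⟨Fintype.piFinset fun _ => Finset.Icc ⌊-(((N : ℝ) + 1) * R)⌋ ⌊((N : ℝ) + 1) * R⌋,
    fun x hx => ?_⟩
  simp only [Set.mem_iUnion, exists_prop]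
  refine ⟨fun i => ⌊((N : ℝ) + 1) * x i⌋, ?_, fun i => rfl⟩
  rw [Fintype.mem_piFinset]
  intro i
  have h1 := (PiLp.norm_apply_le x i).trans (mem_closedBall_zero_iff.1 hx)
  rw [Real.norm_eq_abs, abs_le] at h1
  have hN : (0 : ℝ) < (N : ℝ) + 1 := by positivity
  rw [Finset.mem_Icc]
  exact ⟨Int.floor_le_floor (by nlinarith), Int.floor_le_floor (by nlinarith)⟩

/-- On a convex set of small diameter, the `L²` norm is controlled by the mean and the gradient. -/
theorem lintegral_sq_le_mean_add_gradient {u : Space d → ℝ} (hu : IsTest u) {S : Set (Space d)}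
    (hS : Convex ℝ S) (hSm : MeasurableSet S) (hSf : volume S < ⊤) {D : ENNReal}
    (hD : ∀ x ∈ S, ∀ y ∈ S, ‖x - y‖ₑ ≤ D) :
    ∫⁻ x in S, ‖u x‖ₑ ^ 2 ≤ ENNReal.ofReal ((∫ x in S, u x) ^ 2 / volume.real S)
      + 4 * 2 ^ d * D ^ 2 * ∫⁻ x in S, ‖gradient u x‖ₑ ^ 2 := by
  rcases eq_or_ne (volume S) 0 with h0 | h0
  · rw [Measure.restrict_eq_zero.2 h0]
    simp
  have hfin : IsFiniteMeasure ((volume : Measure (Space d)).restrict S) := ⟨by simpa using hSf⟩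
  have hi : Integrable u (volume.restrict S) :=
    (memLp_one_iff_integrable.1 (hu.memLp 1)).integrableOn
  have hi2 : Integrable (fun x => u x ^ 2) (volume.restrict S) := by
    have h := (hu.memLp 2).integrable_norm_pow (by simp)
    simp only [Real.norm_eq_abs, sq_abs] at h
    exact h.integrableOn
  set I := ∫ x in S, u x with hI
  set J := ∫ x in S, u x ^ 2 with hJ
  set μ := volume.real S with hμ
  have hμpos : 0 < μ := ENNReal.toReal_pos h0 hSf.ne
  have hiq : ∀ a b c : ℝ, Integrable (fun x => a * u x ^ 2 + b * u x + c) (volume.restrict S) :=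
    fun a b c => ((hi2.const_mul a).add (hi.const_mul b)).add (integrable_const c)
  have hquad : ∀ a b c : ℝ, ∫ x in S, (a * u x ^ 2 + b * u x + c) = a * J + b * I + μ * c := by
    intro a b c
    have hi3 : Integrable (fun x => a * u x ^ 2 + b * u x) (volume.restrict S) :=
      (hi2.const_mul a).add (hi.const_mul b)
    rw [integral_add hi3 (integrable_const c), integral_add (hi2.const_mul a) (hi.const_mul b),
      integral_const_mul, integral_const_mul, setIntegral_const, smul_eq_mul]
  have hsq : ∀ x y, (u x - u y) ^ 2 = 1 * u y ^ 2 + (-2 * u x) * u y + u x ^ 2 :=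
    fun x y => by ring
  have hinner : ∀ x, ∫⁻ y in S, ‖u x - u y‖ₑ ^ 2 =
      ENNReal.ofReal (μ * u x ^ 2 + (-2 * I) * u x + J) := fun x => by
    have h1 : μ * u x ^ 2 + (-2 * I) * u x + J = ∫ y in S, (u x - u y) ^ 2 := by
      simp_rw [hsq]
      rw [hquad]
      ring
    simp_rw [real_enorm_sq]
    rw [h1, ofReal_integral_eq_lintegral_ofReal _ (.of_forall fun y => sq_nonneg _)]
    simp_rw [hsq]
    exact hiq _ _ _
  have hinner0 : ∀ x, 0 ≤ μ * u x ^ 2 + (-2 * I) * u x + J := fun x => by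
    have h1 : μ * u x ^ 2 + (-2 * I) * u x + J = ∫ y in S, (u x - u y) ^ 2 := by
      simp_rw [hsq]
      rw [hquad]
      ring
    rw [h1]
    exact integral_nonneg fun y => sq_nonneg _
  have hP := poincare_convex hu.smooth hS hSm hD
  simp_rw [hinner] at hP
  rw [← ofReal_integral_eq_lintegral_ofReal (hiq _ _ _) (.of_forall hinner0), hquad] at hP
  have hμe : volume S = ENNReal.ofReal μ := (ENNReal.ofReal_toReal hSf.ne).symm
  have hJe : ∫⁻ x in S, ‖u x‖ₑ ^ 2 = ENNReal.ofReal J := by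
    simp_rw [real_enorm_sq]
    exact (ofReal_integral_eq_lintegral_ofReal hi2 (.of_forall fun x => sq_nonneg _)).symm
  have hJ0 : 0 ≤ J := integral_nonneg fun x => sq_nonneg _
  set G := ∫⁻ x in S, ‖gradient u x‖ₑ ^ 2
  have hμ0 : ENNReal.ofReal μ ≠ 0 := by simpa using hμpos
  -- The double integral in Poincaré's inequality equals 2μJ - 2I². Adding I² leaves at least μJ,
  -- because I² ≤ μJ by Cauchy–Schwarz.
  have hmain : ENNReal.ofReal μ * ENNReal.ofReal J ≤
      ENNReal.ofReal μ * (ENNReal.ofReal (I ^ 2 / μ) + 4 * 2 ^ d * D ^ 2 * G) := by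
    calc ENNReal.ofReal μ * ENNReal.ofReal J = ENNReal.ofReal (μ * J) :=
          (ENNReal.ofReal_mul hμpos.le).symm
      _ ≤ ENNReal.ofReal (I ^ 2 + (μ * J + -2 * I * I + μ * J)) := by
          refine ENNReal.ofReal_le_ofReal ?_
          have hCS : I ^ 2 ≤ μ * J := by
            have h1 : 0 ≤ ∫ x in S, (μ * u x - I) ^ 2 := integral_nonneg fun x => sq_nonneg _
            have h2 : ∀ x, (μ * u x - I) ^ 2 = μ ^ 2 * u x ^ 2 + (-2 * μ * I) * u x + I ^ 2 :=
              fun x => by ring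
            simp_rw [h2] at h1
            rw [hquad] at h1
            have h3 : 0 ≤ μ * (μ * J - I ^ 2) := by linarith
            have := nonneg_of_mul_nonneg_right h3 hμpos
            linarith
          nlinarith
      _ ≤ ENNReal.ofReal (I ^ 2) + ENNReal.ofReal (μ * J + -2 * I * I + μ * J) :=
          ENNReal.ofReal_add_le
      _ ≤ ENNReal.ofReal (μ * (I ^ 2 / μ)) + 4 * 2 ^ d * D ^ 2 * ENNReal.ofReal μ * G := by
          rw [mul_div_cancel₀ _ hμpos.ne', ← hμe]
          gcongr
      _ = _ := by
          rw [ENNReal.ofReal_mul hμpos.le]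
          ring
  rw [hJe]
  exact (ENNReal.mul_le_mul_iff_right hμ0 ENNReal.ofReal_ne_top).1 hmain

section Compactness

variable {u : ℕ → Space d → ℝ}

theorem eLpNorm_gradient_sub_le (hu : ∀ n, IsTest (u n))
    (hA : ∀ n, eLpNorm (gradient (u n)) 2 volume ≤ 1) (n m : ℕ) :
    eLpNorm (gradient fun x => u n x - u m x) 2 volume ≤ 2 := by
  have h : gradient (fun x => u n x - u m x) = gradient (u n) - gradient (u m) :=
    funext fun x => gradient_fun_sub ((hu n).differentiableAt x) ((hu m).differentiableAt x)
  rw [h]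
  calc eLpNorm (gradient (u n) - gradient (u m)) 2 volume
      ≤ eLpNorm (gradient (u n)) 2 volume + eLpNorm (gradient (u m)) 2 volume :=
        eLpNorm_sub_le ((hu n).memLp_gradient 2).aestronglyMeasurable
          ((hu m).memLp_gradient 2).aestronglyMeasurable one_le_two
    _ ≤ 1 + 1 := add_le_add (hA n) (hA m)
    _ = 2 := one_add_one_eq_two

/-- A sequence of pointwise bounded functions on a countable type has a pointwise convergent
subsequence. -/
theorem exists_subseq_tendsto_of_bounded {ι : Type*} [Countable ι] (f : ℕ → ι → ℝ) {M : ι → ℝ}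
    (hM : ∀ q n, |f n q| ≤ M q) : ∃ (a : ι → ℝ) (φ : ℕ → ℕ), StrictMono φ ∧
      ∀ q, Tendsto (fun n => f (φ n) q) atTop (𝓝 (a q)) := by
  have hK : IsCompact (Set.univ.pi fun q => Set.Icc (-M q) (M q)) :=
    isCompact_univ_pi fun q => isCompact_Icc
  obtain ⟨a, -, φ, hφ, hlim⟩ := hK.tendsto_subseq (x := f) fun n q _ => abs_le.1 (hM q n)
  exact ⟨a, φ, hφ, fun q => tendsto_pi_nhds.1 hlim q⟩

/-- Functions bounded in the homogeneous Sobolev norm have bounded means on sets of finite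
measure. -/
theorem exists_abs_setIntegral_le (hd : 3 ≤ d) (hu : ∀ n, IsTest (u n))
    (hA : ∀ n, eLpNorm (gradient (u n)) 2 volume ≤ 1) {S : Set (Space d)} (hS : volume S < ⊤) :
    ∃ M : ℝ, ∀ n, |∫ x in S, u n x| ≤ M := by
  obtain ⟨C, hC⟩ := exists_sobolev_bound hd
  have hd' : (3 : ℝ) ≤ d := by exact_mod_cast hd
  have hp1 : 1 ≤ ENNReal.ofReal (2 * d / (d - 2)) := by
    rw [ENNReal.one_le_ofReal, le_div_iff₀ (by linarith)]
    linarith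
  have hp2 : 1 ≤ (ENNReal.ofReal (2 * d / (d - 2))).toReal := by
    simpa using ENNReal.toReal_mono ENNReal.ofReal_ne_top hp1
  have hSu : ∀ n, eLpNorm (u n) (ENNReal.ofReal (2 * d / (d - 2))) volume ≤ C := fun n =>
    (hC _ (hu n)).trans (mul_le_of_le_one_right' (hA n))
  generalize ENNReal.ofReal (2 * d / (d - 2)) = p at hp1 hp2 hSu
  set e : ℝ := 1 / (1 : ENNReal).toReal - 1 / p.toReal with he
  have he0 : 0 ≤ e := by
    rw [he, ENNReal.toReal_one, div_one, sub_nonneg, div_le_one (by linarith)]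
    exact hp2
  have hBtop : (C : ENNReal) * (volume.restrict S) Set.univ ^ e ≠ ⊤ :=
    ENNReal.mul_ne_top ENNReal.coe_ne_top (ENNReal.rpow_ne_top_of_nonneg he0 (by simpa using hS.ne))
  refine ⟨((C : ENNReal) * (volume.restrict S) Set.univ ^ e).toReal, fun n => ?_⟩
  have h1 : ‖∫ x in S, u n x‖ₑ ≤ (C : ENNReal) * (volume.restrict S) Set.univ ^ e := by
    calc ‖∫ x in S, u n x‖ₑ ≤ ∫⁻ x in S, ‖u n x‖ₑ := enorm_integral_le_lintegral_enorm _
      _ = eLpNorm (u n) 1 (volume.restrict S) := eLpNorm_one_eq_lintegral_enorm.symm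
      _ ≤ eLpNorm (u n) p (volume.restrict S) * (volume.restrict S) Set.univ ^ e :=
          eLpNorm_le_eLpNorm_mul_rpow_measure_univ hp1 (hu n).continuous.aestronglyMeasurable
      _ ≤ (C : ENNReal) * (volume.restrict S) Set.univ ^ e :=
          mul_le_mul_left ((eLpNorm_restrict_le _ _ _ _).trans (hSu n)) _
  have h2 := ENNReal.toReal_mono hBtop h1
  rwa [toReal_enorm, Real.norm_eq_abs] at h2

/-- Along a subsequence all means over grid cubes converge. -/
theorem exists_subseq_tendsto_mean (hd : 3 ≤ d) (hu : ∀ n, IsTest (u n))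
    (hA : ∀ n, eLpNorm (gradient (u n)) 2 volume ≤ 1) :
    ∃ (a : ℕ × (Fin d → ℤ) → ℝ) (φ : ℕ → ℕ), StrictMono φ ∧
      ∀ q, Tendsto (fun n => ∫ x in gridCube q.1 q.2, u (φ n) x) atTop (𝓝 (a q)) := by
  have hM : ∀ q : ℕ × (Fin d → ℤ), ∃ M : ℝ, ∀ n, |∫ x in gridCube q.1 q.2, u n x| ≤ M := fun q =>
    exists_abs_setIntegral_le hd hu hA (volume_gridCube_lt_top q.1 q.2)
  choose M hM using hM
  obtain ⟨a, φ, h1, h2⟩ := exists_subseq_tendsto_of_bounded (ι := ℕ × (Fin d → ℤ))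
    (fun n q => ∫ x in gridCube q.1 q.2, u n x) hM
  exact ⟨a, φ, h1, h2⟩

/-- Rellich's theorem on balls. -/
theorem tendsto_lintegral_ball_sub (hu : ∀ n, IsTest (u n))
    (hA : ∀ n, eLpNorm (gradient (u n)) 2 volume ≤ 1) {a : ℕ × (Fin d → ℤ) → ℝ}
    (ha : ∀ q, Tendsto (fun n => ∫ x in gridCube q.1 q.2, u n x) atTop (𝓝 (a q))) (R : ℝ) :
    Tendsto (fun p : ℕ × ℕ => ∫⁻ x in Metric.closedBall 0 R, ‖u p.1 x - u p.2 x‖ₑ ^ 2)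
      atTop (𝓝 0) := by
  set D : ℕ → ENNReal := fun N => ENNReal.ofReal (Real.sqrt d / (N + 1)) with hDdef
  -- The Poincaré error summed over all cubes: D N bounds their diameter, and 2² bounds the squared
  -- gradient norm of a difference. The mesh is fixed first; then only finitely many means must
  -- converge.
  have hD : Tendsto (fun N => 4 * 2 ^ d * D N ^ 2 * 2 ^ 2) atTop (𝓝 0) := by
    have h1 : Tendsto D atTop (𝓝 0) := by
      have := (tendsto_one_div_add_atTop_nhds_zero_nat (𝕜 := ℝ)).const_mul (Real.sqrt d)
      rw [mul_zero] at this
      have h2 := ENNReal.tendsto_ofReal this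
      rw [ENNReal.ofReal_zero] at h2
      refine h2.congr fun N => ?_
      rw [hDdef, mul_one_div]
    have h2 : Tendsto (fun N => D N ^ 2) atTop (𝓝 0) := by
      have := ((ENNReal.continuous_pow 2).tendsto 0).comp h1
      rwa [zero_pow two_ne_zero] at this
    have h3 := ENNReal.Tendsto.const_mul (a := 4 * 2 ^ d) h2
      (Or.inr (ENNReal.mul_ne_top (by simp) (by simp)))
    have h4 := ENNReal.Tendsto.mul_const (b := (2 : ENNReal) ^ 2) h3 (Or.inr (by simp))
    simpa using h4
  rw [ENNReal.tendsto_nhds_zero]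
  intro ε hε
  have hε2 : 0 < ε / 2 := by simpa using hε.ne'
  obtain ⟨N, hN⟩ := ((ENNReal.tendsto_nhds_zero.1 hD) (ε / 2) hε2).exists
  obtain ⟨F, hF⟩ := exists_finset_gridCube (d := d) N R
  have hmean : Tendsto (fun p : ℕ × ℕ => ∑ k ∈ F, ENNReal.ofReal
      (((∫ x in gridCube N k, u p.1 x) - ∫ x in gridCube N k, u p.2 x) ^ 2 /
        volume.real (gridCube N k))) atTop (𝓝 0) := by
    rw [← Finset.sum_const_zero (s := F)]
    refine tendsto_finsetSum _ fun k _ => ?_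
    have h1 : Tendsto (fun p : ℕ × ℕ => ∫ x in gridCube N k, u p.1 x) atTop (𝓝 (a (N, k))) := by
      rw [← prod_atTop_atTop_eq]
      exact (ha (N, k)).comp tendsto_fst
    have h2 : Tendsto (fun p : ℕ × ℕ => ∫ x in gridCube N k, u p.2 x) atTop (𝓝 (a (N, k))) := by
      rw [← prod_atTop_atTop_eq]
      exact (ha (N, k)).comp tendsto_snd
    have h3 := ENNReal.tendsto_ofReal (((h1.sub h2).pow 2).div_const (volume.real (gridCube N k)))
    simpa using h3
  filter_upwards [(ENNReal.tendsto_nhds_zero.1 hmean) (ε / 2) hε2] with p hp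
  have ht : IsTest fun x => u p.1 x - u p.2 x := (hu p.1).sub (hu p.2)
  have hmeas : ∀ k ∈ F, MeasurableSet (gridCube N k) := fun k _ => measurableSet_gridCube N k
  have hi : ∀ n k, Integrable (u n) (volume.restrict (gridCube N k)) := fun n k =>
    (memLp_one_iff_integrable.1 ((hu n).memLp 1)).integrableOn
  calc ∫⁻ x in Metric.closedBall 0 R, ‖u p.1 x - u p.2 x‖ₑ ^ 2
      ≤ ∫⁻ x in ⋃ k ∈ F, gridCube N k, ‖u p.1 x - u p.2 x‖ₑ ^ 2 := lintegral_mono_set hF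
    _ = ∑ k ∈ F, ∫⁻ x in gridCube N k, ‖u p.1 x - u p.2 x‖ₑ ^ 2 :=
        lintegral_biUnion_finset (pairwiseDisjoint_gridCube N _) hmeas _
    _ ≤ ∑ k ∈ F, (ENNReal.ofReal
      (((∫ x in gridCube N k, u p.1 x) - ∫ x in gridCube N k, u p.2 x) ^ 2 /
        volume.real (gridCube N k)) + 4 * 2 ^ d * D N ^ 2 *
          ∫⁻ x in gridCube N k, ‖gradient (fun x => u p.1 x - u p.2 x) x‖ₑ ^ 2) := by
        refine Finset.sum_le_sum fun k _ => ?_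
        have h1 := lintegral_sq_le_mean_add_gradient ht (convex_gridCube N k)
          (measurableSet_gridCube N k) (volume_gridCube_lt_top N k) (D := D N) fun x hx y hy => by
            rw [← ofReal_norm]
            exact ENNReal.ofReal_le_ofReal (norm_sub_le_of_mem_gridCube hx hy)
        rwa [integral_sub (hi _ _) (hi _ _)] at h1
    _ = (∑ k ∈ F, ENNReal.ofReal
      (((∫ x in gridCube N k, u p.1 x) - ∫ x in gridCube N k, u p.2 x) ^ 2 /
        volume.real (gridCube N k))) + 4 * 2 ^ d * D N ^ 2 *
          ∫⁻ x in ⋃ k ∈ F, gridCube N k, ‖gradient (fun x => u p.1 x - u p.2 x) x‖ₑ ^ 2 := by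
        rw [Finset.sum_add_distrib, lintegral_biUnion_finset (pairwiseDisjoint_gridCube N _) hmeas,
          Finset.mul_sum]
    _ ≤ ε / 2 + 4 * 2 ^ d * D N ^ 2 * 2 ^ 2 := by
        refine add_le_add hp ?_
        gcongr
        refine (setLIntegral_le_lintegral _ _).trans ?_
        rw [← eLpNorm_two_sq]
        exact pow_le_pow_left' (eLpNorm_gradient_sub_le hu hA _ _) 2
    _ ≤ ε / 2 + ε / 2 := by gcongr
    _ = ε := ENNReal.add_halves ε

/-- The potential energy is a compact perturbation: along a subsequence it is Cauchy. -/
theorem exists_subseq_tendsto_potential (hd : 3 ≤ d) {v : Space d → ℝ}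
    (hv : MemLp v (ENNReal.ofReal (d / 2)) (volume : Measure (Space d)))
    (hu : ∀ n, IsTest (u n)) (hA : ∀ n, eLpNorm (gradient (u n)) 2 volume ≤ 1) :
    ∃ φ : ℕ → ℕ, StrictMono φ ∧ Tendsto (fun p : ℕ × ℕ =>
      ∫⁻ x, ‖v x‖ₑ * ‖u (φ p.1) x - u (φ p.2) x‖ₑ ^ 2) atTop (𝓝 0) := by
  obtain ⟨a, φ, hφ, ha⟩ := exists_subseq_tendsto_mean hd hu hA
  obtain ⟨C, hC⟩ := exists_sobolev_bound hd
  refine ⟨φ, hφ, ?_⟩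
  rw [ENNReal.tendsto_nhds_zero]
  intro ε hε
  have hε2 : 0 < ε / 2 := by simpa using hε.ne'
  -- The tolerance for approximating v in L^{d/2}; C · 2 is the Sobolev bound for a difference of
  -- two members of the sequence.
  obtain ⟨δ, hδ, hδε⟩ : ∃ δ : ENNReal, δ ≠ 0 ∧ δ * ((C : ENNReal) * 2) ^ 2 ≤ ε / 2 := by
    have h1 : Tendsto (fun δ : ENNReal => δ * ((C : ENNReal) * 2) ^ 2) (𝓝 0)
        (𝓝 (0 * ((C : ENNReal) * 2) ^ 2)) :=
      ENNReal.Tendsto.mul_const tendsto_id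
        (Or.inr (ENNReal.pow_ne_top (ENNReal.mul_ne_top (by simp) (by simp))))
    rw [zero_mul] at h1
    have h2 := ((ENNReal.tendsto_nhds_zero.1 h1 (ε / 2) hε2).filter_mono
      (nhdsWithin_le_nhds (s := {0}ᶜ))).and self_mem_nhdsWithin
    obtain ⟨δ, h3, h4⟩ := h2.exists
    exact ⟨δ, h4, h3⟩
  obtain ⟨g, hgc, hgv, hgcont, -⟩ := hv.exists_hasCompactSupport_eLpNorm_sub_le
    ENNReal.ofReal_ne_top hδ
  obtain ⟨M, hM⟩ := hgc.exists_bound_of_continuous hgcont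
  obtain ⟨R, hR⟩ := hgc.isCompact.isBounded.subset_closedBall (0 : Space d)
  have hball := tendsto_lintegral_ball_sub (fun n => hu (φ n)) (fun n => hA (φ n)) ha R
  have hball2 := ENNReal.Tendsto.const_mul (a := ENNReal.ofReal M) hball
    (Or.inr ENNReal.ofReal_ne_top)
  rw [mul_zero] at hball2
  filter_upwards [(ENNReal.tendsto_nhds_zero.1 hball2) (ε / 2) hε2] with p hp
  have ht : IsTest fun x => u (φ p.1) x - u (φ p.2) x := (hu _).sub (hu _)
  set w := fun x => u (φ p.1) x - u (φ p.2) x with hw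
  have hvg : AEStronglyMeasurable (v - g) volume :=
    hv.aestronglyMeasurable.sub hgcont.aestronglyMeasurable
  have hwm : Measurable fun x => ‖w x‖ₑ ^ 2 := ht.continuous.enorm.measurable.pow_const 2
  calc ∫⁻ x, ‖v x‖ₑ * ‖w x‖ₑ ^ 2
      ≤ ∫⁻ x, (‖(v - g) x‖ₑ * ‖w x‖ₑ ^ 2 + ‖g x‖ₑ * ‖w x‖ₑ ^ 2) := by
        refine lintegral_mono fun x => ?_
        rw [← add_mul]
        gcongr
        have := enorm_add_le (v x - g x) (g x)
        rwa [sub_add_cancel] at this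
    _ = (∫⁻ x, ‖(v - g) x‖ₑ * ‖w x‖ₑ ^ 2) + ∫⁻ x, ‖g x‖ₑ * ‖w x‖ₑ ^ 2 :=
        lintegral_add_right _ (hgcont.enorm.measurable.mul hwm)
    _ ≤ ε / 2 + ε / 2 := by
        gcongr
        · refine ((lintegral_mul_sq_le hd hvg ht.continuous.aestronglyMeasurable).trans ?_).trans hδε
          gcongr
          exact (hC _ ht).trans (by gcongr; exact eLpNorm_gradient_sub_le hu hA _ _)
        · refine le_trans ?_ hp
          rw [← lintegral_const_mul _ hwm, ← lintegral_indicator measurableSet_closedBall]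
          refine lintegral_mono fun x => ?_
          by_cases hx : x ∈ Metric.closedBall (0 : Space d) R
          · rw [Set.indicator_of_mem hx]
            gcongr
            rw [← ofReal_norm]
            exact ENNReal.ofReal_le_ofReal (hM x)
          · have : g x = 0 := image_eq_zero_of_notMem_tsupport fun h => hx (hR h)
            simp [this]
    _ = ε := ENNReal.add_halves ε

end Compactness

/-! ### The strong limit and its equation -/

/-- Completeness of `L^p`, for functions rather than classes. -/
theorem exists_memLp_tendsto_of_cauchy {α E : Type*} [MeasurableSpace α] {μ : Measure α}
    [NormedAddCommGroup E] [CompleteSpace E] {p : ENNReal} (hp : 1 ≤ p) {f : ℕ → α → E}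
    (hf : ∀ n, MemLp (f n) p μ)
    (hc : Tendsto (fun q : ℕ × ℕ => eLpNorm (f q.1 - f q.2) p μ) atTop (𝓝 0)) :
    ∃ g, MemLp g p μ ∧ Tendsto (fun n => eLpNorm (f n - g) p μ) atTop (𝓝 0) := by
  have : Fact (1 ≤ p) := ⟨hp⟩
  have hcs : CauchySeq fun n => (hf n).toLp (f n) := by
    rw [cauchySeq_iff_tendsto_dist_atTop_0]
    have h1 := (ENNReal.tendsto_toReal ENNReal.zero_ne_top).comp hc
    rw [ENNReal.toReal_zero] at h1
    refine h1.congr fun q => ?_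
    rw [dist_edist, Lp.edist_toLp_toLp]
    rfl
  obtain ⟨g, hg⟩ := cauchySeq_tendsto_of_complete hcs
  refine ⟨g, Lp.memLp g, ?_⟩
  rw [← Lp.tendsto_Lp_iff_tendsto_eLpNorm'' f hf g (Lp.memLp g), Lp.toLp_coeFn]
  exact hg

/-- Pairing with a fixed element of the dual exponent is continuous in `L^p`. -/
theorem tendsto_integral_mul_of_tendsto_eLpNorm {α : Type*} [MeasurableSpace α] {μ : Measure α}
    {p q : ENNReal} [hpq : p.HolderConjugate q] {f : ℕ → α → ℝ} {g h : α → ℝ}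
    (hf : ∀ n, MemLp (f n) p μ) (hg : MemLp g p μ) (hh : MemLp h q μ)
    (ht : Tendsto (fun n => eLpNorm (f n - g) p μ) atTop (𝓝 0)) :
    Tendsto (fun n => ∫ x, f n x * h x ∂μ) atTop (𝓝 (∫ x, g x * h x ∂μ)) := by
  have hi : ∀ {k : α → ℝ}, MemLp k p μ → Integrable (fun x => k x * h x) μ := fun hk =>
    memLp_one_iff_integrable.1 (hh.mul hk)
  refine tendsto_integral_of_L1 _ (hi hg).aestronglyMeasurable (.of_forall fun n => hi (hf n)) ?_
  have h1 : Tendsto (fun n => eLpNorm (f n - g) p μ * eLpNorm h q μ) atTop (𝓝 0) := by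
    simpa using ENNReal.Tendsto.mul_const ht (Or.inr hh.eLpNorm_ne_top)
  refine tendsto_of_tendsto_of_tendsto_of_le_of_le tendsto_const_nhds h1 (fun n => zero_le)
    fun n => ?_
  have h2 := eLpNorm_smul_le_mul_eLpNorm (r := 1) hh.aestronglyMeasurable
    ((hf n).sub hg).aestronglyMeasurable (hpqr := hpq)
  rw [eLpNorm_one_eq_lintegral_enorm] at h2
  refine le_trans (le_of_eq (lintegral_congr fun x => ?_)) h2
  simp [sub_mul]

theorem one_le_sobolevExponent (hd : 3 ≤ d) : 1 ≤ ENNReal.ofReal (2 * d / (d - 2)) := by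
  have hd' : (3 : ℝ) ≤ d := by exact_mod_cast hd
  rw [ENNReal.one_le_ofReal, le_div_iff₀ (by linarith)]
  linarith

theorem holderConjugate_sobolevExponent (hd : 3 ≤ d) :
    (ENNReal.ofReal (2 * d / (d - 2))).HolderConjugate (ENNReal.ofReal (2 * d / (d + 2))) := by
  have hd' : (3 : ℝ) ≤ d := by exact_mod_cast hd
  have hd2 : (0 : ℝ) < d - 2 := by linarith
  have : (2 * d / (d - 2) : ℝ).HolderConjugate (2 * d / (d + 2)) := by
    rw [Real.holderConjugate_iff]
    constructor
    · rw [lt_div_iff₀ hd2]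
      linarith
    · field_simp
      ring
  exact this.ennrealOfReal

section Limit

variable {m : ℝ} {v : Space d → ℝ} {ψ : ℕ → Space d → ℝ}

theorem eLpNorm_gradient_eq_one {u : Space d → ℝ} (hu : IsTest u)
    (h : ∫ x, ‖gradient u x‖ ^ 2 = 1) : eLpNorm (gradient u) 2 volume = 1 := by
  have h1 := lintegral_gradient_sq hu
  rw [h, ← eLpNorm_two_sq, ENNReal.ofReal_one] at h1
  exact (ENNReal.pow_right_strictMono two_ne_zero).injective (by simpa using h1)

/-- A minimizing sequence with convergent potential energy is Cauchy in the homogeneous Sobolev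
norm. -/
theorem tendsto_eLpNorm_gradient_sub (hm : 0 < m) (hv : LocallyIntegrable v volume)
    (hpos : ∀ φ, IsTest φ → 0 ≤ energy m v φ φ) (hψ : ∀ n, IsTest (ψ n))
    (hE : Tendsto (fun n => energy m v (ψ n) (ψ n)) atTop (𝓝 0))
    (hV : Tendsto (fun p : ℕ × ℕ => ∫⁻ x, ‖v x‖ₑ * ‖ψ p.1 x - ψ p.2 x‖ₑ ^ 2) atTop (𝓝 0)) :
    Tendsto (fun p : ℕ × ℕ => eLpNorm (gradient fun x => ψ p.1 x - ψ p.2 x) 2 volume)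
      atTop (𝓝 0) := by
  have hm2 : 0 < 2 * m := by positivity
  have hE1 : Tendsto (fun p : ℕ × ℕ => energy m v (ψ p.1) (ψ p.1)) atTop (𝓝 0) := by
    rw [← prod_atTop_atTop_eq]
    exact hE.comp tendsto_fst
  have hE2 : Tendsto (fun p : ℕ × ℕ => energy m v (ψ p.2) (ψ p.2)) atTop (𝓝 0) := by
    rw [← prod_atTop_atTop_eq]
    exact hE.comp tendsto_snd
  -- The gradient term is isolated in the energy of the difference: it is at most the parallelogram
  -- bound plus the absolute potential energy, times 2m.
  have hbd : Tendsto (fun p : ℕ × ℕ => ENNReal.ofReal (2 * m) *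
      (ENNReal.ofReal (2 * energy m v (ψ p.1) (ψ p.1) + 2 * energy m v (ψ p.2) (ψ p.2))
      + ∫⁻ x, ‖v x‖ₑ * ‖ψ p.1 x - ψ p.2 x‖ₑ ^ 2)) atTop (𝓝 0) := by
    have h1 := ENNReal.tendsto_ofReal ((hE1.const_mul 2).add (hE2.const_mul 2))
    have h2 := ENNReal.Tendsto.const_mul (a := ENNReal.ofReal (2 * m)) (h1.add hV)
      (Or.inr ENNReal.ofReal_ne_top)
    simpa using h2
  have hsq : Tendsto (fun p : ℕ × ℕ => eLpNorm (gradient fun x => ψ p.1 x - ψ p.2 x) 2 volume ^ 2)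
      atTop (𝓝 0) := by
    refine tendsto_of_tendsto_of_tendsto_of_le_of_le tendsto_const_nhds hbd (fun _ => zero_le)
      fun p => ?_
    have ht := (hψ p.1).sub (hψ p.2)
    have h1 := energy_sub_self_le hv hpos (hψ p.1) (hψ p.2)
    rw [energy_self_eq hv ht] at h1
    have h2 : -∫ x, v x * (ψ p.1 x - ψ p.2 x) ^ 2 ≤
        (∫⁻ x, ‖v x‖ₑ * ‖ψ p.1 x - ψ p.2 x‖ₑ ^ 2).toReal := by
      rw [← integral_neg]
      refine (Real.le_norm_self _).trans ((norm_integral_le_lintegral_norm _).trans_eq ?_)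
      congr 1
      refine lintegral_congr fun x => ?_
      rw [ofReal_norm, enorm_neg, enorm_mul, enorm_pow]
    have hfin : ∫⁻ x, ‖v x‖ₑ * ‖ψ p.1 x - ψ p.2 x‖ₑ ^ 2 ≠ ⊤ := by
      have h3 := ((ht.mul_smooth ht.smooth).integrable_mul hv).hasFiniteIntegral
      rw [HasFiniteIntegral] at h3
      refine ne_of_lt (lt_of_le_of_lt (le_of_eq (lintegral_congr fun x => ?_)) h3)
      rw [enorm_mul, enorm_mul, pow_two]
    simp only
    rw [eLpNorm_two_sq, lintegral_gradient_sq ht]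
    calc ENNReal.ofReal (∫ x, ‖gradient (fun x => ψ p.1 x - ψ p.2 x) x‖ ^ 2)
        ≤ ENNReal.ofReal (2 * m * ((2 * energy m v (ψ p.1) (ψ p.1)
          + 2 * energy m v (ψ p.2) (ψ p.2))
          + (∫⁻ x, ‖v x‖ₑ * ‖ψ p.1 x - ψ p.2 x‖ₑ ^ 2).toReal)) := by
          refine ENNReal.ofReal_le_ofReal ?_
          have h4 : 1 / (2 * m) * (∫ x, ‖gradient (fun x => ψ p.1 x - ψ p.2 x) x‖ ^ 2) ≤
              (2 * energy m v (ψ p.1) (ψ p.1) + 2 * energy m v (ψ p.2) (ψ p.2))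
              + (∫⁻ x, ‖v x‖ₑ * ‖ψ p.1 x - ψ p.2 x‖ₑ ^ 2).toReal := by linarith
          rwa [one_div, inv_mul_le_iff₀ hm2] at h4
      _ = _ := by
          rw [ENNReal.ofReal_mul hm2.le, ENNReal.ofReal_add, ENNReal.ofReal_toReal hfin]
          · have := hpos _ (hψ p.1)
            have := hpos _ (hψ p.2)
            positivity
          · exact ENNReal.toReal_nonneg
  have h5 := (ENNReal.continuous_rpow_const (y := (1 / 2 : ℝ))).tendsto 0 |>.comp hsq
  rw [ENNReal.zero_rpow_of_pos (by norm_num)] at h5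
  refine h5.congr fun p => ?_
  rw [Function.comp_apply, ← ENNReal.rpow_natCast, ← ENNReal.rpow_mul]
  norm_num

/-- The minimizing sequence converges in the homogeneous Sobolev space. -/
theorem exists_strong_limit (hd : 3 ≤ d) (hm : 0 < m) (hv : LocallyIntegrable v volume)
    (hpos : ∀ φ, IsTest φ → 0 ≤ energy m v φ φ) (hψ : ∀ n, IsTest (ψ n))
    (hE : Tendsto (fun n => energy m v (ψ n) (ψ n)) atTop (𝓝 0))
    (hV : Tendsto (fun p : ℕ × ℕ => ∫⁻ x, ‖v x‖ₑ * ‖ψ p.1 x - ψ p.2 x‖ₑ ^ 2) atTop (𝓝 0)) :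
    ∃ (f : Space d → ℝ) (G : Space d → Space d),
      MemLp f (ENNReal.ofReal (2 * d / (d - 2))) volume ∧ MemLp G 2 volume ∧
      Tendsto (fun n => eLpNorm (gradient (ψ n) - G) 2 volume) atTop (𝓝 0) ∧
      Tendsto (fun n => eLpNorm (ψ n - f) (ENNReal.ofReal (2 * d / (d - 2))) volume)
        atTop (𝓝 0) := by
  obtain ⟨C, hC⟩ := exists_sobolev_bound hd
  have hg := tendsto_eLpNorm_gradient_sub hm hv hpos hψ hE hV
  have hu : Tendsto (fun p : ℕ × ℕ => eLpNorm (ψ p.1 - ψ p.2)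
      (ENNReal.ofReal (2 * d / (d - 2))) volume) atTop (𝓝 0) := by
    have h1 := ENNReal.Tendsto.const_mul (a := (C : ENNReal)) hg (Or.inr ENNReal.coe_ne_top)
    rw [mul_zero] at h1
    exact tendsto_of_tendsto_of_tendsto_of_le_of_le tendsto_const_nhds h1 (fun _ => zero_le)
      fun p => hC _ ((hψ p.1).sub (hψ p.2))
  have hg' : Tendsto (fun p : ℕ × ℕ => eLpNorm (gradient (ψ p.1) - gradient (ψ p.2)) 2 volume)
      atTop (𝓝 0) := by
    refine hg.congr fun p => ?_
    congr 1
    exact funext fun x => gradient_fun_sub ((hψ p.1).differentiableAt x)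
      ((hψ p.2).differentiableAt x)
  obtain ⟨f, hf, hf'⟩ := exists_memLp_tendsto_of_cauchy (one_le_sobolevExponent hd)
    (fun n => (hψ n).memLp _) hu
  obtain ⟨G, hG, hG'⟩ := exists_memLp_tendsto_of_cauchy one_le_two
    (fun n => (hψ n).memLp_gradient 2) hg'
  exact ⟨f, G, hf, hG, hG', hf'⟩

/-- The limit of a minimizing sequence does not vanish. -/
theorem not_ae_zero_of_limit (hd : 3 ≤ d) (hm : 0 < m) (hv : LocallyIntegrable v volume)
    (hv2 : MemLp v (ENNReal.ofReal (d / 2)) volume) (hψ : ∀ n, IsTest (ψ n))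
    (hnorm : ∀ n, ∫ x, ‖gradient (ψ n) x‖ ^ 2 = 1)
    (hE : Tendsto (fun n => energy m v (ψ n) (ψ n)) atTop (𝓝 0)) {f : Space d → ℝ}
    (hf : Tendsto (fun n => eLpNorm (ψ n - f) (ENNReal.ofReal (2 * d / (d - 2))) volume)
      atTop (𝓝 0)) : ¬ f =ᵐ[volume] 0 := by
  intro h0
  have h1 : Tendsto (fun n => eLpNorm (ψ n) (ENNReal.ofReal (2 * d / (d - 2))) volume)
      atTop (𝓝 0) := by
    refine hf.congr fun n => eLpNorm_congr_ae ?_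
    filter_upwards [h0] with x hx
    simp [hx]
  have h2 : Tendsto (fun n => ∫⁻ x, ‖v x‖ₑ * ‖ψ n x‖ₑ ^ 2) atTop (𝓝 0) := by
    have h3 := ((ENNReal.continuous_pow 2).tendsto 0).comp h1
    have h4 := ENNReal.Tendsto.const_mul (a := eLpNorm v (ENNReal.ofReal (d / 2)) volume) h3
      (Or.inr hv2.eLpNorm_ne_top)
    rw [zero_pow two_ne_zero, mul_zero] at h4
    exact tendsto_of_tendsto_of_tendsto_of_le_of_le tendsto_const_nhds h4 (fun _ => zero_le)
      fun n => lintegral_mul_sq_le hd hv2.aestronglyMeasurable (hψ n).continuous.aestronglyMeasurable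
  have h5 : Tendsto (fun n => ∫ x, v x * ψ n x ^ 2) atTop (𝓝 0) := by
    rw [tendsto_zero_iff_norm_tendsto_zero]
    have h6 := (ENNReal.tendsto_toReal ENNReal.zero_ne_top).comp h2
    refine squeeze_zero (fun _ => norm_nonneg _) (fun n => ?_) h6
    refine (norm_integral_le_lintegral_norm _).trans_eq ?_
    rw [Function.comp_apply]
    congr 1
    refine lintegral_congr fun x => ?_
    rw [ofReal_norm, enorm_mul, enorm_pow]
  -- The normalization fixes the kinetic part, so a vanishing potential part would make the energies
  -- tend to 1/(2m) instead of 0.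
  have h7 : ∀ n, energy m v (ψ n) (ψ n) = 1 / (2 * m) + ∫ x, v x * ψ n x ^ 2 := fun n => by
    rw [energy_self_eq hv (hψ n), hnorm n, mul_one]
  simp_rw [h7] at hE
  have h8 := tendsto_nhds_unique hE (h5.const_add (1 / (2 * m)))
  have : 0 < 1 / (2 * m) := by positivity
  linarith

/-- The limit of a minimizing sequence solves the Schrödinger equation. -/
theorem isDistributionalSolution_of_limit (hd : 3 ≤ d) (hv : IsShortRange v)
    (hpos : ∀ φ, IsTest φ → 0 ≤ energy m v φ φ) (hψ : ∀ n, IsTest (ψ n))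
    (hE : Tendsto (fun n => energy m v (ψ n) (ψ n)) atTop (𝓝 0)) {f : Space d → ℝ}
    (hfp : MemLp f (ENNReal.ofReal (2 * d / (d - 2))) volume)
    (hf : Tendsto (fun n => eLpNorm (ψ n - f) (ENNReal.ofReal (2 * d / (d - 2))) volume)
      atTop (𝓝 0)) : IsDistributionalSolution m v f := by
  have hd' : (3 : ℝ) ≤ d := by exact_mod_cast hd
  have hvl := hv.locallyIntegrable (by omega)
  have hconj := holderConjugate_sobolevExponent hd
  -- The exponent dual to 2d/(d-2) is at most d, so v is locally in the dual space and vf is locally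
  -- integrable.
  have hq : ENNReal.ofReal (2 * d / (d + 2)) ≤ d := by
    rw [← ENNReal.ofReal_natCast]
    refine ENNReal.ofReal_le_ofReal ?_
    rw [div_le_iff₀ (by linarith)]
    nlinarith
  refine ⟨hfp.locallyIntegrable (one_le_sobolevExponent hd), ?_, fun φ hφ hφc => ?_⟩
  · rw [locallyIntegrable_iff]
    intro K hK
    have h1 : MemLp (v * f) 1 (volume.restrict K) :=
      (hfp.restrict K).mul (hpqr := hconj.symm) (hv.memLp_ball hq hK)
    exact memLp_one_iff_integrable.1 h1
  · have hφt : IsTest φ := ⟨hφ, hφc⟩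
    -- A fixed element of the dual space; convergence of ψ_n in L^{2d/(d-2)} then suffices, and the
    -- weak gradient of f plays no role.
    set h : Space d → ℝ := fun x => -(1 / (2 * m)) * (Δ φ) x + v x * φ x with hh
    have hhq : MemLp h (ENNReal.ofReal (2 * d / (d + 2))) volume := by
      have h1 : MemLp (Δ φ) (ENNReal.ofReal (2 * d / (d + 2))) (volume : Measure (Space d)) :=
        (contDiff_laplacian hφ).continuous.memLp_of_hasCompactSupport
          (hasCompactSupport_laplacian hφc)
      exact (h1.const_mul _).add
        (memLp_mul_of_hasCompactSupport (fun K hK => hv.memLp_ball hq hK) hφ.continuous hφc)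
    have hlim := tendsto_integral_mul_of_tendsto_eLpNorm (fun n => (hψ n).memLp _) hfp hhq hf
    have heq : ∀ n, ∫ x, ψ n x * h x = energy m v (ψ n) φ := fun n => by
      rw [energy_eq_integral hvl (hψ n) hφt]
      congr 1
      ext x
      simp only [hh]
      ring
    have hzero : Tendsto (fun n => energy m v (ψ n) φ) atTop (𝓝 0) := by
      have h1 : Tendsto (fun n => energy m v (ψ n) φ ^ 2) atTop (𝓝 0) := by
        have h2 := hE.mul_const (energy m v φ φ)
        rw [zero_mul] at h2
        exact squeeze_zero (fun n => sq_nonneg _) (fun n => energy_sq_le hvl hpos (hψ n) hφt) h2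
      rw [tendsto_zero_iff_abs_tendsto_zero]
      have h3 := (Real.continuous_sqrt.tendsto 0).comp h1
      rw [Real.sqrt_zero] at h3
      exact h3.congr fun n => Real.sqrt_sq_eq_abs _
    simp_rw [heq] at hlim
    rw [tendsto_nhds_unique hzero hlim]
    congr 1
    ext x
    simp only [hh]
    ring

end Limit

/-! ### Positivity of the limit -/

section LogEstimate

variable {m δ : ℝ} {v φ ψ : Space d → ℝ}

/-- The logarithmic test function `φ² / (ψ + δ)`. -/
def logTest (δ : ℝ) (φ ψ : Space d → ℝ) (x : Space d) : ℝ := φ x * φ x * (ψ x + δ)⁻¹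

theorem isTest_logTest (hδ : 0 < δ) (hφ : IsTest φ) (hψ : IsTest ψ) (hψ0 : ∀ x, 0 ≤ ψ x) :
    IsTest (logTest δ φ ψ) :=
  (hφ.mul_smooth hφ.smooth).mul_smooth
    ((hψ.smooth.add contDiff_const).inv fun x => (add_pos_of_nonneg_of_pos (hψ0 x) hδ).ne')

theorem gradient_logTest (hδ : 0 < δ) (hφ : IsTest φ) (hψ : IsTest ψ) (hψ0 : ∀ x, 0 ≤ ψ x)
    (x : Space d) : gradient (logTest δ φ ψ) x = (2 * φ x * (ψ x + δ)⁻¹) • gradient φ x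
      - (φ x ^ 2 * (ψ x + δ)⁻¹ ^ 2) • gradient ψ x := by
  have hpos : 0 < ψ x + δ := add_pos_of_nonneg_of_pos (hψ0 x) hδ
  have h1 : HasDerivAt (fun s : ℝ => (s + δ)⁻¹) (-1 / (ψ x + δ) ^ 2) (ψ x) :=
    ((hasDerivAt_id (ψ x)).add_const δ).inv hpos.ne'
  have h2 := gradient_comp_deriv h1 (hψ.differentiableAt x)
  have h3 : DifferentiableAt ℝ (fun y => (ψ y + δ)⁻¹) x :=
    ((hψ.differentiableAt x).add_const δ).inv hpos.ne'
  have h4 : DifferentiableAt ℝ (fun y => φ y * φ y) x :=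
    (hφ.differentiableAt x).mul (hφ.differentiableAt x)
  have h5 : gradient (logTest δ φ ψ) x = _ := gradient_fun_mul h4 h3
  rw [h5, h2, gradient_fun_mul (hφ.differentiableAt x) (hφ.differentiableAt x)]
  simp only [smul_smul, smul_add]
  rw [← add_smul, sub_eq_add_neg, ← neg_smul, add_comm]
  congr 2
  · ring
  · field_simp

/-- The logarithm of `1 + ψ / δ`. -/
def logRatio (δ : ℝ) (ψ : Space d → ℝ) (x : Space d) : ℝ := Real.log (1 + ψ x / δ)

theorem isTest_logRatio (hδ : 0 < δ) (hψ : IsTest ψ) (hψ0 : ∀ x, 0 ≤ ψ x) :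
    IsTest (logRatio δ ψ) := by
  refine hψ.comp (F := fun s => Real.log (1 + s / δ)) (fun x => ?_) (by simp)
  have : 0 ≤ ψ x / δ := div_nonneg (hψ0 x) hδ.le
  exact ContDiffAt.log (by fun_prop) (by positivity)

theorem gradient_logRatio (hδ : 0 < δ) (hψ : IsTest ψ) (hψ0 : ∀ x, 0 ≤ ψ x) (x : Space d) :
    gradient (logRatio δ ψ) x = (ψ x + δ)⁻¹ • gradient ψ x := by
  have h0 : 0 ≤ ψ x / δ := div_nonneg (hψ0 x) hδ.le
  have h1 : HasDerivAt (fun s : ℝ => Real.log (1 + s / δ)) (1 / δ / (1 + ψ x / δ)) (ψ x) :=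
    (((hasDerivAt_id (ψ x)).div_const δ).const_add 1).log (by positivity)
  have h2 : gradient (logRatio δ ψ) x = _ :=
    gradient_comp_deriv (F := fun s => Real.log (1 + s / δ)) h1 (hψ.differentiableAt x)
  rw [h2]
  have h3 : δ * (1 + ψ x / δ) = ψ x + δ := by
    rw [mul_add, mul_one, mul_div_cancel₀ _ hδ.ne', add_comm]
  rw [div_div, h3, one_div]

/-- The gradient of 1/(ψ + δ) contributes -φ²|∇log(ψ + δ)|² to the form. The cross term with ∇φ is
absorbed by Young's inequality at the cost of half of this, and ψ/(ψ + δ) ≤ 1 controls the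
potential. The right-hand side depends on neither δ nor ψ. -/
theorem integral_sq_gradient_logRatio_le (hm : 0 < m) (hδ : 0 < δ)
    (hv : LocallyIntegrable v volume) (hφ : IsTest φ) (hψ : IsTest ψ) (hψ0 : ∀ x, 0 ≤ ψ x) :
    energy m v ψ (logTest δ φ ψ)
      + 1 / (2 * m) / 2 * (∫ x, φ x ^ 2 * ‖gradient (logRatio δ ψ) x‖ ^ 2) ≤
    1 / (2 * m) * 2 * (∫ x, ‖gradient φ x‖ ^ 2) + ∫ x, |v x| * φ x ^ 2 := by
  have hη := isTest_logTest hδ hφ hψ hψ0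
  have hw := isTest_logRatio hδ hψ hψ0
  have hi1 : Integrable fun x => φ x ^ 2 * ‖gradient (logRatio δ ψ) x‖ ^ 2 :=
    ((hφ.continuous.pow 2).mul (hw.continuous_gradient.norm.pow 2)).integrable_of_hasCompactSupport
      (by simpa only [pow_two] using (hφ.compact.mul_right (f' := φ)).mul_right)
  have hi2 : Integrable fun x => ‖gradient φ x‖ ^ 2 :=
    (hφ.memLp_gradient 2).integrable_norm_pow (by simp)
  have hi3 : Integrable fun x => |v x| * φ x ^ 2 := by
    refine ((hφ.mul_smooth hφ.smooth).integrable_mul hv).norm.congr (.of_forall fun x => ?_)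
    simp [pow_two]
  rw [energy, ← integral_const_mul, ← integral_const_mul, ← integral_add
    (energy_integrable hv hψ hη) (hi1.const_mul _), ← integral_add (hi2.const_mul _) hi3]
  refine integral_mono ((energy_integrable hv hψ hη).add (hi1.const_mul _))
    ((hi2.const_mul _).add hi3) fun x => ?_
  have hpos : 0 < ψ x + δ := add_pos_of_nonneg_of_pos (hψ0 x) hδ
  simp only
  rw [gradient_logTest hδ hφ hψ hψ0, gradient_logRatio hδ hψ hψ0, inner_sub_right,
    real_inner_smul_right, real_inner_smul_right, real_inner_self_eq_norm_sq, norm_smul, mul_pow,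
    Real.norm_eq_abs, sq_abs]
  have hCS := real_inner_le_norm (gradient ψ x) (gradient φ x)
  have hCS' := (abs_le.1 (abs_real_inner_le_norm (gradient ψ x) (gradient φ x)))
  set r := (ψ x + δ)⁻¹ with hr
  have hr0 : 0 < r := inv_pos.2 hpos
  set A := ‖gradient ψ x‖
  set B := ‖gradient φ x‖
  set I := inner ℝ (gradient ψ x) (gradient φ x)
  have hquad : 2 * φ x * r * I ≤ φ x ^ 2 * (r ^ 2 * A ^ 2) / 2 + 2 * B ^ 2 := by
    have h1 : |2 * φ x * r * I| ≤ 2 * |φ x| * r * (A * B) := by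
      rw [abs_mul, abs_mul, abs_mul, abs_two, abs_of_pos hr0]
      exact mul_le_mul_of_nonneg_left (abs_le.2 hCS') (by positivity)
    have h2 := sq_nonneg (|φ x| * (r * A) - 2 * B)
    have h3 : |φ x| ^ 2 = φ x ^ 2 := sq_abs _
    have h4 := (le_abs_self _).trans h1
    have h5 : (|φ x| * (r * A) - 2 * B) ^ 2 =
        φ x ^ 2 * (r ^ 2 * A ^ 2) - 2 * (2 * |φ x| * r * (A * B)) + 4 * B ^ 2 := by
      rw [← h3]
      ring
    linarith
  have hpot : v x * (ψ x * logTest δ φ ψ x) ≤ |v x| * φ x ^ 2 := by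
    have h1 : ψ x * r ≤ 1 := by
      rw [hr, ← div_eq_mul_inv, div_le_one hpos]
      linarith
    have h2 : 0 ≤ ψ x * r := mul_nonneg (hψ0 x) hr0.le
    have h3 : ψ x * logTest δ φ ψ x = φ x ^ 2 * (ψ x * r) := by
      rw [logTest, ← hr]
      ring
    rw [h3]
    calc v x * (φ x ^ 2 * (ψ x * r)) ≤ |v x| * (φ x ^ 2 * (ψ x * r)) :=
          mul_le_mul_of_nonneg_right (le_abs_self _) (by positivity)
      _ ≤ |v x| * (φ x ^ 2 * 1) := by gcongr
      _ = _ := by rw [mul_one]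
  have hc : 0 < 1 / (2 * m) := by positivity
  have := mul_le_mul_of_nonneg_left hquad hc.le
  nlinarith

/-- A crude bound that deteriorates as δ → 0. It is needed only at fixed δ, where Cauchy–Schwarz
multiplies it by E(ψ_n) → 0. -/
theorem energy_logTest_le (hm : 0 < m) (hδ : 0 < δ) (hv : LocallyIntegrable v volume)
    (hφ : IsTest φ) (hφ1 : ∀ x, |φ x| ≤ 1) (hψ : IsTest ψ) (hψ0 : ∀ x, 0 ≤ ψ x) :
    energy m v (logTest δ φ ψ) (logTest δ φ ψ) ≤
      1 / (2 * m) * (8 * δ⁻¹ ^ 2 * (∫ x, ‖gradient φ x‖ ^ 2)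
        + 2 * δ⁻¹ ^ 4 * ∫ x, ‖gradient ψ x‖ ^ 2) + δ⁻¹ ^ 2 * ∫ x, |v x| * φ x ^ 2 := by
  have hη := isTest_logTest hδ hφ hψ hψ0
  have hi2 : ∀ {u : Space d → ℝ}, IsTest u → Integrable fun x => ‖gradient u x‖ ^ 2 := fun hu =>
    (hu.memLp_gradient 2).integrable_norm_pow (by simp)
  have hi3 : Integrable fun x => |v x| * φ x ^ 2 := by
    refine ((hφ.mul_smooth hφ.smooth).integrable_mul hv).norm.congr (.of_forall fun x => ?_)
    simp [pow_two]
  have hr : ∀ x, 0 < (ψ x + δ)⁻¹ ∧ (ψ x + δ)⁻¹ ≤ δ⁻¹ := fun x => by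
    have hpos : 0 < ψ x + δ := add_pos_of_nonneg_of_pos (hψ0 x) hδ
    exact ⟨inv_pos.2 hpos, inv_anti₀ hδ (by linarith [hψ0 x])⟩
  rw [energy_self_eq hv hη]
  refine add_le_add (mul_le_mul_of_nonneg_left ?_ (by positivity)) ?_
  · rw [← integral_const_mul, ← integral_const_mul,
      ← integral_add ((hi2 hφ).const_mul _) ((hi2 hψ).const_mul _)]
    refine integral_mono (hi2 hη) (((hi2 hφ).const_mul _).add ((hi2 hψ).const_mul _)) fun x => ?_
    simp only
    obtain ⟨hr0, hr1⟩ := hr x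
    rw [gradient_logTest hδ hφ hψ hψ0]
    set r := (ψ x + δ)⁻¹
    have hφx : φ x ^ 2 ≤ 1 := by
      rw [← sq_abs]
      exact pow_le_one₀ (abs_nonneg _) (hφ1 x)
    have hφr : |2 * φ x * r| ≤ 2 * δ⁻¹ := by
      rw [abs_mul, abs_mul, abs_two, abs_of_pos hr0]
      calc 2 * |φ x| * r ≤ 2 * 1 * δ⁻¹ := by gcongr; exact hφ1 x
        _ = 2 * δ⁻¹ := by ring
    have hφr2 : |φ x ^ 2 * r ^ 2| ≤ δ⁻¹ ^ 2 := by
      rw [abs_of_nonneg (by positivity)]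
      calc φ x ^ 2 * r ^ 2 ≤ 1 * δ⁻¹ ^ 2 := by gcongr
        _ = _ := one_mul _
    have h1 : ‖(2 * φ x * r) • gradient φ x - (φ x ^ 2 * r ^ 2) • gradient ψ x‖ ≤
        2 * δ⁻¹ * ‖gradient φ x‖ + δ⁻¹ ^ 2 * ‖gradient ψ x‖ := by
      refine (norm_sub_le _ _).trans ?_
      rw [norm_smul, norm_smul, Real.norm_eq_abs, Real.norm_eq_abs]
      gcongr
    calc ‖(2 * φ x * r) • gradient φ x - (φ x ^ 2 * r ^ 2) • gradient ψ x‖ ^ 2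
        ≤ (2 * δ⁻¹ * ‖gradient φ x‖ + δ⁻¹ ^ 2 * ‖gradient ψ x‖) ^ 2 :=
          pow_le_pow_left₀ (norm_nonneg _) h1 2
      _ ≤ _ := by
          nlinarith [sq_nonneg (2 * δ⁻¹ * ‖gradient φ x‖ - δ⁻¹ ^ 2 * ‖gradient ψ x‖)]
  · rw [← integral_const_mul]
    have hi4 : Integrable fun x => v x * logTest δ φ ψ x ^ 2 := by
      simpa only [pow_two] using (hη.mul_smooth hη.smooth).integrable_mul hv
    refine integral_mono hi4 (hi3.const_mul _) fun x => ?_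
    simp only
    obtain ⟨hr0, hr1⟩ := hr x
    have hφx : φ x ^ 2 ≤ 1 := by
      rw [← sq_abs]
      exact pow_le_one₀ (abs_nonneg _) (hφ1 x)
    calc v x * logTest δ φ ψ x ^ 2 ≤ |v x| * logTest δ φ ψ x ^ 2 :=
          mul_le_mul_of_nonneg_right (le_abs_self _) (sq_nonneg _)
      _ = |v x| * (φ x ^ 2 * φ x ^ 2 * (ψ x + δ)⁻¹ ^ 2) := by
          rw [logTest]
          ring
      _ ≤ |v x| * (φ x ^ 2 * 1 * δ⁻¹ ^ 2) := by gcongr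
      _ = _ := by ring

end LogEstimate

section Positivity

variable {m : ℝ} {v : Space d → ℝ} {ψ : ℕ → Space d → ℝ}

/-- Along a minimizing sequence the logarithms have locally bounded gradients, uniformly in the
regularization. -/
theorem exists_bound_gradient_logRatio (hm : 0 < m) (hv : LocallyIntegrable v volume)
    (hpos : ∀ φ, IsTest φ → 0 ≤ energy m v φ φ) (hψ : ∀ n, IsTest (ψ n))
    (hψ0 : ∀ n x, 0 ≤ ψ n x) (hnorm : ∀ n, ∫ x, ‖gradient (ψ n) x‖ ^ 2 = 1)
    (hE : Tendsto (fun n => energy m v (ψ n) (ψ n)) atTop (𝓝 0)) {R : ℝ} (hR : 0 < R) :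
    ∃ K : ENNReal, K ≠ ⊤ ∧ ∀ δ : ℝ, 0 < δ → ∀ᶠ n in atTop,
      ∫⁻ x in Metric.closedBall (0 : Space d) R, ‖gradient (logRatio δ (ψ n)) x‖ₑ ^ 2 ≤ K := by
  let g : ContDiffBump (0 : Space d) := ⟨R, R + 1, hR, by linarith⟩
  have hg : IsTest g := ⟨g.contDiff, g.hasCompactSupport⟩
  have hg1 : ∀ x, |g x| ≤ 1 := fun x => by
    rw [abs_of_nonneg g.nonneg]
    exact g.le_one
  set c : ℝ := 1 / (2 * m) with hc
  have hc0 : 0 < c := by positivity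
  set A : ℝ := c * 2 * (∫ x, ‖gradient g x‖ ^ 2) + ∫ x, |v x| * g x ^ 2 with hA
  -- The summand 1 dominates |E(ψ_n, φ²/(ψ_n + δ))| for large n. Only the threshold for n depends on
  -- δ, through B; the bound itself does not.
  refine ⟨ENNReal.ofReal (2 / c * (A + 1)), ENNReal.ofReal_ne_top, fun δ hδ => ?_⟩
  set B : ℝ := c * (8 * δ⁻¹ ^ 2 * (∫ x, ‖gradient g x‖ ^ 2)
        + 2 * δ⁻¹ ^ 4 * 1) + δ⁻¹ ^ 2 * ∫ x, |v x| * g x ^ 2 with hB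
  have hlim : Tendsto (fun n => energy m v (ψ n) (ψ n) * B) atTop (𝓝 0) := by
    simpa using hE.mul_const B
  filter_upwards [hlim.eventually (gt_mem_nhds one_pos)] with n hn
  have hη := isTest_logTest hδ hg (hψ n) (hψ0 n)
  have h1 := integral_sq_gradient_logRatio_le hm hδ hv hg (hψ n) (hψ0 n)
  have h2 := energy_logTest_le hm hδ hv hg hg1 (hψ n) (hψ0 n)
  rw [hnorm n] at h2
  have h3 := energy_sq_le hv hpos (hψ n) hη
  have h4 : energy m v (ψ n) (logTest δ g (ψ n)) ^ 2 ≤ 1 :=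
    (h3.trans (mul_le_mul_of_nonneg_left h2 (hpos _ (hψ n)))).trans hn.le
  have h5 := (abs_le.1 ((sq_le_one_iff_abs_le_one _).1 h4)).1
  have hw := isTest_logRatio hδ (hψ n) (hψ0 n)
  have hi : Integrable fun x => g x ^ 2 * ‖gradient (logRatio δ (ψ n)) x‖ ^ 2 :=
    ((hg.continuous.pow 2).mul (hw.continuous_gradient.norm.pow 2)).integrable_of_hasCompactSupport
      (by simpa only [pow_two] using (hg.compact.mul_right (f' := g)).mul_right)
  have h6 : ∫ x, g x ^ 2 * ‖gradient (logRatio δ (ψ n)) x‖ ^ 2 ≤ 2 / c * (A + 1) := by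
    have h7 : c / 2 * (∫ x, g x ^ 2 * ‖gradient (logRatio δ (ψ n)) x‖ ^ 2) ≤ A + 1 := by linarith
    have h8 := mul_le_mul_of_nonneg_left h7 (show 0 ≤ 2 / c by positivity)
    rwa [← mul_assoc, div_mul_div_cancel₀ hc0.ne', div_self two_ne_zero, one_mul] at h8
  calc ∫⁻ x in Metric.closedBall (0 : Space d) R, ‖gradient (logRatio δ (ψ n)) x‖ₑ ^ 2
      ≤ ∫⁻ x in Metric.closedBall (0 : Space d) R,
          ENNReal.ofReal (g x ^ 2 * ‖gradient (logRatio δ (ψ n)) x‖ ^ 2) := by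
        refine setLIntegral_mono' measurableSet_closedBall fun x hx => ?_
        rw [g.one_of_mem_closedBall hx, one_pow, one_mul, ENNReal.ofReal_pow (norm_nonneg _),
          ofReal_norm]
    _ ≤ ∫⁻ x, ENNReal.ofReal (g x ^ 2 * ‖gradient (logRatio δ (ψ n)) x‖ ^ 2) :=
        setLIntegral_le_lintegral _ _
    _ = ENNReal.ofReal (∫ x, g x ^ 2 * ‖gradient (logRatio δ (ψ n)) x‖ ^ 2) :=
        (ofReal_integral_eq_lintegral_ofReal hi (.of_forall fun x => by positivity)).symm
    _ ≤ _ := ENNReal.ofReal_le_ofReal h6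

/-- Fatou's lemma for the mean oscillation. -/
theorem lintegral_oscillation_le_of_tendsto {w : ℕ → Space d → ℝ} {g : Space d → ℝ}
    {S : Set (Space d)} (hw : ∀ i, Continuous (w i))
    (hg : ∀ᵐ x, Tendsto (fun i => w i x) atTop (𝓝 (g x))) {K : ENNReal}
    (hK : ∀ᶠ i in atTop, ∫⁻ x in S, ∫⁻ y in S, ‖w i x - w i y‖ₑ ^ 2 ≤ K) :
    ∫⁻ x in S, ∫⁻ y in S, ‖g x - g y‖ₑ ^ 2 ≤ K := by
  have hmx : ∀ x i, Measurable fun y : Space d => ‖w i x - w i y‖ₑ ^ 2 := fun x i =>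
    (continuous_const.sub (hw i)).enorm.measurable.pow_const 2
  have hmint : ∀ i, Measurable fun x : Space d => ∫⁻ y in S, ‖w i x - w i y‖ₑ ^ 2 := fun i => by
    have h2 : Continuous fun q : Space d × Space d => w i q.1 - w i q.2 :=
      ((hw i).comp continuous_fst).sub ((hw i).comp continuous_snd)
    have h3 : Measurable fun q : Space d × Space d => ‖w i q.1 - w i q.2‖ₑ ^ 2 :=
      h2.enorm.measurable.pow_const 2
    exact h3.lintegral_prod_right'
  have hinner : ∀ᵐ x ∂(volume.restrict S), ∫⁻ y in S, ‖g x - g y‖ₑ ^ 2 ≤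
      liminf (fun i => ∫⁻ y in S, ‖w i x - w i y‖ₑ ^ 2) atTop := by
    filter_upwards [ae_restrict_of_ae hg] with x hx
    -- Fatou is applied in y for almost every fixed x, and then once more in x.
    refine le_trans (le_of_eq (lintegral_congr_ae ?_)) (lintegral_liminf_le (hmx x))
    filter_upwards [ae_restrict_of_ae hg] with y hy
    exact (ENNReal.Tendsto.pow (hx.sub hy).enorm).liminf_eq.symm
  exact (lintegral_mono_ae hinner).trans ((lintegral_liminf_le hmint).trans
    (liminf_le_of_frequently_le' hK.frequently))

/-- The mean oscillation of the logarithm of the limit is bounded on balls. -/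
theorem exists_bound_oscillation_logRatio (hm : 0 < m) (hv : LocallyIntegrable v volume)
    (hpos : ∀ φ, IsTest φ → 0 ≤ energy m v φ φ) (hψ : ∀ n, IsTest (ψ n))
    (hψ0 : ∀ n x, 0 ≤ ψ n x) (hnorm : ∀ n, ∫ x, ‖gradient (ψ n) x‖ ^ 2 = 1)
    (hE : Tendsto (fun n => energy m v (ψ n) (ψ n)) atTop (𝓝 0)) {f : Space d → ℝ}
    (hf0 : ∀ᵐ x, 0 ≤ f x)
    {ns : ℕ → ℕ} (hns : StrictMono ns)
    (hae : ∀ᵐ x, Tendsto (fun i => ψ (ns i) x) atTop (𝓝 (f x))) {R : ℝ} (hR : 0 < R) :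
    ∃ K : ENNReal, K ≠ ⊤ ∧ ∀ δ : ℝ, 0 < δ →
      ∫⁻ x in Metric.closedBall (0 : Space d) R, ∫⁻ y in Metric.closedBall (0 : Space d) R,
        ‖logRatio δ f x - logRatio δ f y‖ₑ ^ 2 ≤ K := by
  obtain ⟨K, hK, hKb⟩ := exists_bound_gradient_logRatio hm hv hpos hψ hψ0 hnorm hE hR
  have hSf : volume (Metric.closedBall (0 : Space d) R) ≠ ⊤ := measure_closedBall_lt_top.ne
  refine ⟨4 * 2 ^ d * ENNReal.ofReal (R + R) ^ 2 * volume (Metric.closedBall (0 : Space d) R) * K,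
    ENNReal.mul_ne_top (ENNReal.mul_ne_top (by finiteness) hSf) hK, fun δ hδ => ?_⟩
  have hw : ∀ n, IsTest (logRatio δ (ψ n)) := fun n => isTest_logRatio hδ (hψ n) (hψ0 n)
  refine lintegral_oscillation_le_of_tendsto (w := fun i => logRatio δ (ψ (ns i)))
    (fun i => (hw (ns i)).continuous) ?_ ?_
  · filter_upwards [hae, hf0] with x hx hx0
    have h0 : 0 ≤ f x / δ := div_nonneg hx0 hδ.le
    exact ((hx.div_const δ).const_add 1).log (by positivity)
  · filter_upwards [hns.tendsto_atTop.eventually (hKb δ hδ)] with i hi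
    refine (poincare_convex (hw (ns i)).smooth (convex_closedBall 0 R) measurableSet_closedBall
      (D := ENNReal.ofReal (R + R)) fun x hx y hy => ?_).trans (mul_le_mul_right hi _)
    rw [← ofReal_norm]
    refine ENNReal.ofReal_le_ofReal ((norm_sub_le x y).trans (add_le_add ?_ ?_))
    · exact mem_closedBall_zero_iff.1 hx
    · exact mem_closedBall_zero_iff.1 hy

/-- A nonnegative function whose logarithm has bounded mean oscillation on balls, uniformly in the
regularization, is positive almost everywhere or vanishes almost everywhere. -/
theorem ae_pos_of_bound_oscillation {f : Space d → ℝ} (hfm : Measurable f)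
    (hf0 : ∀ᵐ x, 0 ≤ f x) (hfne : ¬ f =ᵐ[volume] 0)
    (hosc : ∀ R : ℝ, 0 < R → ∃ K : ENNReal, K ≠ ⊤ ∧ ∀ δ : ℝ, 0 < δ →
      ∫⁻ x in Metric.closedBall (0 : Space d) R, ∫⁻ y in Metric.closedBall (0 : Space d) R,
        ‖logRatio δ f x - logRatio δ f y‖ₑ ^ 2 ≤ K) : ∀ᵐ x, 0 < f x := by
  by_contra hcon
  have hZ : volume (⋃ n : ℕ, {x : Space d | f x = 0} ∩ Metric.closedBall 0 n) ≠ 0 := by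
    rw [← Set.inter_iUnion, Metric.iUnion_closedBall_nat, Set.inter_univ]
    intro h0
    refine hcon ?_
    have h1 : ∀ᵐ x : Space d, ¬ f x = 0 := by
      rw [ae_iff]
      simpa using h0
    filter_upwards [h1, hf0] with x hx1 hx2
    exact lt_of_le_of_ne hx2 (Ne.symm hx1)
  -- These sets exhaust {f > 0}. One of them has positive measure, lies in a ball, and carries a
  -- uniform lower bound for f.
  have hP : volume (⋃ n : ℕ, {x : Space d | 1 / ((n : ℝ) + 1) ≤ f x} ∩ Metric.closedBall 0 n) ≠ 0 := by
    intro h0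
    refine hfne ?_
    have h1 := measure_eq_zero_iff_ae_notMem.1 h0
    filter_upwards [h1, hf0] with x hx1 hx2
    by_contra hx3
    have hx4 : 0 < f x := lt_of_le_of_ne hx2 (Ne.symm hx3)
    obtain ⟨n₁, hn₁⟩ := exists_nat_one_div_lt hx4
    obtain ⟨n₂, hn₂⟩ := exists_nat_ge ‖x‖
    refine hx1 (Set.mem_iUnion.2 ⟨max n₁ n₂, ?_, ?_⟩)
    · refine le_trans ?_ hn₁.le
      exact one_div_le_one_div_of_le (by positivity) (by gcongr; exact le_max_left _ _)
    · rw [mem_closedBall_zero_iff]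
      exact hn₂.trans (by exact_mod_cast le_max_right _ _)
  obtain ⟨n₁, hn₁⟩ := exists_measure_pos_of_not_measure_iUnion_null hZ
  obtain ⟨n₂, hn₂⟩ := exists_measure_pos_of_not_measure_iUnion_null hP
  set s : ℝ := 1 / ((n₂ : ℝ) + 1) with hs
  have hs0 : 0 < s := by positivity
  set R : ℝ := (n₁ : ℝ) + n₂ + 1 with hR
  have hR0 : 0 < R := by positivity
  set S := Metric.closedBall (0 : Space d) R with hS
  set Z := {x : Space d | f x = 0} ∩ Metric.closedBall 0 n₁ with hZdef
  set P := {x : Space d | s ≤ f x} ∩ Metric.closedBall 0 n₂ with hPdef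
  have hZm : MeasurableSet Z := (hfm (measurableSet_singleton 0)).inter measurableSet_closedBall
  have hPm : MeasurableSet P := (measurableSet_le measurable_const hfm).inter measurableSet_closedBall
  have hZS : Z ⊆ S := Set.inter_subset_right.trans (Metric.closedBall_subset_closedBall (by
    rw [hR]
    have : (0 : ℝ) ≤ n₂ := by positivity
    linarith))
  have hPS : P ⊆ S := Set.inter_subset_right.trans (Metric.closedBall_subset_closedBall (by
    rw [hR]
    have : (0 : ℝ) ≤ n₁ := by positivity
    linarith))
  have hSf : volume S ≠ ⊤ := measure_closedBall_lt_top.ne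
  have hZf : volume Z ≠ ⊤ := ne_top_of_le_ne_top hSf (measure_mono hZS)
  have hPf : volume P ≠ ⊤ := ne_top_of_le_ne_top hSf (measure_mono hPS)
  obtain ⟨K, hK, hKb⟩ := hosc R hR0
  have hkey : ∀ T : ℝ, 0 < T → ENNReal.ofReal (T ^ 2) * volume P * volume Z ≤ K := by
    intro T hT
    have hexp : 0 < Real.exp T - 1 := by
      have := Real.add_one_lt_exp hT.ne'
      linarith
    -- Chosen so that log(1 + s/δ) = T: the logarithm is at least T on P and 0 on Z.
    set δ : ℝ := s / (Real.exp T - 1) with hδ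
    have hδ0 : 0 < δ := by positivity
    have hsδ : s / δ = Real.exp T - 1 := by
      rw [hδ]
      field_simp
    refine le_trans ?_ (hKb δ hδ0)
    calc ENNReal.ofReal (T ^ 2) * volume P * volume Z
        = ∫⁻ _x in Z, ∫⁻ _y in P, ENNReal.ofReal (T ^ 2) := by
          rw [setLIntegral_const, setLIntegral_const]
      _ ≤ ∫⁻ x in Z, ∫⁻ y in P, ‖logRatio δ f x - logRatio δ f y‖ₑ ^ 2 := by
          refine setLIntegral_mono' hZm fun x hx => setLIntegral_mono' hPm fun y hy => ?_
          have hx0 : f x = 0 := hx.1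
          have hy0 : s ≤ f y := hy.1
          have h1 : logRatio δ f x = 0 := by simp [logRatio, hx0]
          have h2 : T ≤ logRatio δ f y := by
            rw [logRatio, Real.le_log_iff_exp_le]
            · have : s / δ ≤ f y / δ := by gcongr
              linarith
            · have : 0 ≤ f y / δ := div_nonneg (hs0.le.trans hy0) hδ0.le
              positivity
          rw [real_enorm_sq, h1, zero_sub, neg_sq]
          exact ENNReal.ofReal_le_ofReal (pow_le_pow_left₀ hT.le h2 2)
      _ ≤ ∫⁻ x in S, ∫⁻ y in S, ‖logRatio δ f x - logRatio δ f y‖ₑ ^ 2 :=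
          (lintegral_mono fun x => lintegral_mono_set hPS).trans (lintegral_mono_set hZS)
  set a : ℝ := (volume P).toReal * (volume Z).toReal with ha
  have ha0 : 0 < a := mul_pos (ENNReal.toReal_pos hn₂.ne' hPf) (ENNReal.toReal_pos hn₁.ne' hZf)
  have hT0 : 0 ≤ K.toReal / a := div_nonneg ENNReal.toReal_nonneg ha0.le
  -- For T = K/a + 1 the product T²a exceeds K by a((K/a)² + K/a + 1) > 0, against the uniform
  -- bound.
  have h1 := ENNReal.toReal_mono hK (hkey (K.toReal / a + 1) (by positivity))
  rw [ENNReal.toReal_mul, ENNReal.toReal_mul, ENNReal.toReal_ofReal (sq_nonneg _), mul_assoc,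
    ← ha] at h1
  have h2 : K.toReal / a * a = K.toReal := div_mul_cancel₀ _ ha0.ne'
  have h3 : 0 < a * ((K.toReal / a) ^ 2 + K.toReal / a + 1) := by positivity
  nlinarith

end Positivity

/-- A virtual level has a positive zero-energy solution in the homogeneous Sobolev space. -/
theorem HasVirtualLevel.exists_positive_solution (hd : 3 ≤ d) {m : ℝ} (hm : 0 < m)
    {v : Space d → ℝ} (hv : IsShortRange v) (hlevel : HasVirtualLevel m v) :
    ∃ f : Space d → ℝ, MemHomogeneousSobolev f ∧ (∀ᵐ x, 0 < f x) ∧ ¬ f =ᵐ[volume] 0 ∧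
      IsDistributionalSolution m v f := by
  have hvl := hv.locallyIntegrable (by omega)
  have hv2 := hv.memLp_half (by omega)
  have hpos : ∀ φ, IsTest φ → 0 ≤ energy m v φ φ := fun φ hφ =>
    energy_nonneg_of_isNonneg hv (by omega) hlevel.1 hφ
  obtain ⟨ψ', hψ', hψ0', hnorm', hE'⟩ := exists_minimizing_sequence hm (by omega) hv hlevel
  obtain ⟨k, hk, hV⟩ := exists_subseq_tendsto_potential hd hv2 hψ'
    fun n => (eLpNorm_gradient_eq_one (hψ' n) (hnorm' n)).le
  set ψ : ℕ → Space d → ℝ := fun n => ψ' (k n)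
  have hψ : ∀ n, IsTest (ψ n) := fun n => hψ' (k n)
  have hψ0 : ∀ n x, 0 ≤ ψ n x := fun n => hψ0' (k n)
  have hnorm : ∀ n, ∫ x, ‖gradient (ψ n) x‖ ^ 2 = 1 := fun n => hnorm' (k n)
  have hE : Tendsto (fun n => energy m v (ψ n) (ψ n)) atTop (𝓝 0) := hE'.comp hk.tendsto_atTop
  obtain ⟨f₀, G, hf₀, hG, hGlim, hflim₀⟩ := exists_strong_limit hd hm hvl hpos hψ hE hV
  -- A measurable representative, so that the level sets in the positivity argument are measurable.
  obtain ⟨f, hfm, hff₀⟩ := hf₀.aestronglyMeasurable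
  have hf : MemLp f (ENNReal.ofReal (2 * d / (d - 2))) volume := hf₀.ae_eq hff₀
  have hflim : Tendsto (fun n => eLpNorm (ψ n - f) (ENNReal.ofReal (2 * d / (d - 2))) volume)
      atTop (𝓝 0) :=
    hflim₀.congr fun n => eLpNorm_congr_ae (EventuallyEq.rfl.sub hff₀)
  have hp0 : ENNReal.ofReal (2 * d / (d - 2)) ≠ 0 :=
    (one_pos.trans_le (one_le_sobolevExponent hd)).ne'
  -- An almost everywhere convergent subsequence serves twice: it gives f ≥ 0, and the pointwise
  -- limits that Fatou's lemma needs.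
  obtain ⟨ns, hns, hae⟩ := (tendstoInMeasure_of_tendsto_eLpNorm hp0
    (fun n => (hψ n).continuous.aestronglyMeasurable) hfm.aestronglyMeasurable
    hflim).exists_seq_tendsto_ae
  have hf0 : ∀ᵐ x, 0 ≤ f x := hae.mono fun x hx => ge_of_tendsto' hx fun n => hψ0 _ x
  have hfne := not_ae_zero_of_limit hd hm hvl hv2 hψ hnorm hE hflim
  exact ⟨f, ⟨hf, ψ, G, fun n => ⟨(hψ n).smooth, (hψ n).compact⟩, hG, hGlim, hflim⟩,
    ae_pos_of_bound_oscillation hfm.measurable hf0 hfne fun R hR =>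
      exists_bound_oscillation_logRatio hm hvl hpos hψ hψ0 hnorm hE hf0 hns hae hR,
    hfne, isDistributionalSolution_of_limit hd hv hpos hψ hE hf hflim⟩

end VirtualLevel

end

theorem mainTheorem3 (d : ℕ) (hd : 4 ≤ d) (m : ℝ) (hm : 0 < m)
    (v : VirtualLevel.Space d → ℝ) (hv : VirtualLevel.IsShortRange v)
    (hlevel : VirtualLevel.HasVirtualLevel m v) :
    ∃ f : VirtualLevel.Space d → ℝ,
      VirtualLevel.MemHomogeneousSobolev f ∧
      (∀ᵐ x ∂(volume : Measure (VirtualLevel.Space d)), 0 < f x) ∧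
      ¬ f =ᵐ[volume] 0 ∧
      VirtualLevel.IsDistributionalSolution m v f :=
  hlevel.exists_positive_solution (by omega) hm hv
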